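/- **Automata.** A $(\min,+)$ weighted automaton $\mathcal A=\langle Q,\Sigma,q_0,\Delta\rangle$ has a finite state set $Q$, and for all $p,q\in Q$, $\sigma\in\Sigma$ exactly one transition $(p,\sigma,c,q)\in\Delta$, with $c\in\mathbb Z\cup\{\infty\}$. For states $s,r$ of a weighted automaton and a word $w$, $\mathsf{mwt}(s\xrightarrow{w}r)$ is the minimal weight (sum of transition weights) of a run from $s$ to $r$ on $w$ ($\infty$ if there is no run of finite weight; "there is a run" means $\mathsf{mwt}<\infty$); $\mathsf{mwt}(s\xrightarrow{w}S)$ is the minimum over $r\in S$; $\delta(S',w)$ is the set of states reachable by runs on $w$ from states in $S'$; $\mathsf{xconf}(s,w)$ is the configuration $q\mapsto\mathsf{mwt}(s\xrightarrow{w}q)$; $\mathsf{maxeff}(w)$ is the sum over the letters of $w$ of the maximal absolute value of a finite transition weight on that letter. **Baseline augmentation.** Let $S=\{(q,p,T): T\subseteq Q,\ q,p\in T\}$, $s_0=(q_0,q_0,\{q_0\})$, $\mathfrak m=|S|\cdot|S|!$. A state $(p,p,T)$ is a baseline state. The standard letters are the transitions $(p,\sigma,c,q)\in\Delta$. If $c<\infty$,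 the letter $(p,\sigma,c,q)$ has transitions $(p_1,p,T)\to(p_2,q,\delta_{\mathcal A}(T,\sigma))$ of weight $c'-c$, where $(p_1,\sigma,c',p_2)\in\Delta$; all other transitions have weight $\infty$. **Stable cycles and letters.** A pair $(B,w)$ is a stable cycle if $B=\{(p,q,T):p\in T\}$ for some $T$ and some $q\in T$, $\delta(B,w)\subseteq B$, and for every $n\in\mathbb N$ the state $s=(q,q,T)$ satisfies $\mathsf{mwt}(s\xrightarrow{w^n}s)=0\le \mathsf{mwt}(r\xrightarrow{w^n}r)$ for all $r\in B$. Let $\mathrm{Min}(B,w^{\mathfrak m})$ be the set of $g\in B$ with $\mathsf{mwt}(g\xrightarrow{w^{\mathfrak m}}g)=0$. A pair $(s,r)\in B\times B$ is grounded if $s\xrightarrow{w^{\mathfrak m}}g\xrightarrow{w^{\mathfrak m}}r$ for some $g\in \mathrm{Min}(B,w^{\mathfrak m})$. $(B,w)$ is degenerate if for all $s,t\in B$ such that $t\xrightarrow{w^{2\mathfrak m}}t$ and $s\xrightarrow{w^{2\mathfrak mk}}t$ for some $k\ge1$, the pair $(s,t)$ is grounded. The following letters are formed inductively over words $w$ of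 letters already formed. * The cactus letter $\alpha_{B,w}$ of a stable cycle has, for each grounded pair $(s,r)$, a transition $s\to r$ of weight $\min_{g\in \mathrm{Min}(B,w^{\mathfrak m})}\bigl(\mathsf{mwt}(s\xrightarrow{w^{\mathfrak m}}g)+\mathsf{mwt}(g\xrightarrow{w^{\mathfrak m}}r)\bigr)$; its other transitions have weight $\infty$. * For a grounded pair $s=(q_1,p,T)$, $r=(q_2,p,T)$ whose transition on $\alpha_{B,w}$ has weight $c$, the rebase letter $\beta_{B,w,s\to r}$ has a transition $(q',q_1,T)\to(q'',q_2,T)$ of weight $d-c$ for each transition $(q',p,T)\to(q'',p,T)$ of finite weight $d$ on $\alpha_{B,w}$. * For $s=(q,p_1,T)$, $r=(q,p_2,T)$ the jump letter $\mathsf{jump}_{s\to r}$ has the transitions $(q',p_1,T)\to(q',p_2,T)$ of weight $0$. The depth of a standard letter (and, by convention, of the empty word) is $0$, that of a word is the maximal depth of its letters, and that of $\alpha_{B,w}$ and $\beta_{B,w,s\to r}$ is $1+\mathsf{dep}(w)$. **Effective alphabets.** For $L:\mathbb N\to\mathbb N$, let $\Upsilon_L$ consist of the standard letters and of the cactus letters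 $\alpha_{B,w}$ of depth $k\le|S|-1$ such that $(B,w)$ is a non-degenerate stable cycle, $w\in\Upsilon_L^*$ and $|w|\le L(k)$. Let $\Upsilon_L^{\mathrm{reb}}$ add to $\Upsilon_L$ the rebase letters of its cactus letters, let $\Upsilon_L^{\mathrm{jump}}$ add to $\Upsilon_L^{\mathrm{reb}}$ all jump letters, and let $\Upsilon_L^{\mathrm{cac}}$ be the set of $\alpha_{B,w}$ with $(B,w)$ a stable cycle, $w\in(\Upsilon_L^{\mathrm{reb}})^*$ and $|w|\le L(\mathsf{dep}(w)+1)$. Fix arbitrary length bounds $L_{\mathsf{simp}},L_{\mathsf{gen}}:\mathbb N\to\mathbb N$. The simple effective alphabet is $\Upsilon=\Upsilon_{L_{\mathsf{simp}}}$, and a suffix is a word in $(\Upsilon_{L_{\mathsf{simp}}}^{\mathrm{jump}})^*\cdot\Upsilon_{L_{\mathsf{gen}}}^{\mathrm{cac}}$. **Potential and witnesses.** A state $q$ is dominant in a configuration $\vec c$ if $\vec c(q)<\infty$ and there is a suffix $z$ with $\mathsf{mwt}(q\xrightarrow{z}S)<\infty$ and $\mathsf{mwt}(p\xrightarrow{z}S)=\infty$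 whenever $\vec c(p)<\vec c(q)$. The potential $\phi(w)$ is defined if $w$ contains no jump letter, there is a run of finite weight from $s_0$ on $w$ that visits only baseline states and each prefix of which has minimal weight among the runs from $s_0$ on the same word to the same state, and $\vec c=\mathsf{xconf}(s_0,w)$ has a dominant state; then $\phi(w)=\max\{\vec c(q): q\text{ dominant in }\vec c\}$. A type-0 witness consists of $w_1\in\Upsilon^*$, $\alpha_{B',w_2}\in\Upsilon$ and a suffix $w_3$ such that $B'$ is the set of all states that agree in their last two components with a state in $\delta(\{s_0\},w_1)$, $\delta(\{s_0\},w_1)=\delta(\{s_0\},w_1w_2^{2\mathfrak m})$, $\mathsf{mwt}(s_0\xrightarrow{w_1w_2^{2\mathfrak m}w_3}S)<\infty$ and $\mathsf{mwt}(s_0\xrightarrow{w_1\alpha_{B',w_2}w_3}S)=\infty$. **Theorem (unfolding maintains potential).** Let $u\,\alpha_{B,x}\,v\in\Upsilon^*$ and let $F\in\mathbb N$ with $F\ge 2\,\mathsf{maxeff}(u\,\alpha_{B,x}\,v)$. There exists $M_0\in\mathbb N$ such that $(*)$ for all $k\ge M_0$ and $s,r\in B$: if $(s,r)$ is not grounded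 for $(B,x)$ then $\mathsf{mwt}(s\xrightarrow{x^{2\mathfrak mk}}r)>F$, and if it is grounded then $\mathsf{mwt}(s\xrightarrow{x^{2\mathfrak mk}}r)=\mathsf{mwt}(s\xrightarrow{\alpha_{B,x}}r)$. For every $M_0$ satisfying $(*)$ and every prefix $v'$ of $v$: 1. $\mathsf{xconf}(s_0,u\,x^{2\mathfrak mM_0}v')\le\mathsf{xconf}(s_0,u\,\alpha_{B,x}\,v')$ componentwise. 2. Either there is a type-0 witness, or $\phi(u\,x^{2\mathfrak mM_0}v')=\phi(u\,\alpha_{B,x}\,v')$ in the following sense: if $\phi(u\,\alpha_{B,x}\,v')$ is defined, then $\phi(u\,x^{2\mathfrak mM_0}v')$ is defined and equal to it; and if $u\,\alpha_{B,x}$ can be read from $s_0$ (i.e. $\delta(\{s_0\},u\,\alpha_{B,x})\neq\emptyset$) and $\phi(u\,x^{2\mathfrak mM_0}v')$ is defined, then $\phi(u\,\alpha_{B,x}\,v')$ is defined and equal to it. -/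

import Mathlib

namespace CactusWFA

/-- Weights: integers extended by infinity. Infinity stands for a missing transition. -/
abbrev Weight := WithTop ℤ

/-- Subtraction of weights, used only with a finite subtrahend; it is infinite as soon as one of
the arguments is. -/
def wsub : Weight → Weight → Weight
  | some a, some b => ((a - b : ℤ) : Weight)
  | _, _ => ⊤

section General

variable {Γ S : Type*} [Fintype S] [DecidableEq S] (wt : Γ → S → S → Weight)

/-- The word `w ^ n`. -/
def wpow (w : List Γ) (n : ℕ) : List Γ := (List.replicate n w).flatten

/-- The stabilisation constant `|S| * |S|!`. -/
def bigM (S : Type*) [Fintype S] : ℕ := Fintype.card S * (Fintype.card S).factorial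

/-- A run from a state `s` is given by its list of (letter, target state) pairs. Its weight is the
sum of the weights of its transitions; the sequence is an actual run iff this sum is finite. -/
def runWeight : S → List (Γ × S) → Weight
  | _, [] => 0
  | s, (a, t) :: ρ => wt a s t + runWeight t ρ

/-- The last state of a run from `s`. -/
def runEnd : S → List (Γ × S) → S
  | s, [] => s
  | _, (_, t) :: ρ => runEnd t ρ

/-- `mwt wt w s r`: the minimal weight of a run from `s` to `r` on the word `w`
(see `mwt_le_runWeight` and `exists_runWeight_eq_mwt`). -/
def mwt : List Γ → S → S → Weight
  | [], s, r => if s = r then 0 else ⊤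
  | a :: w, s, r => Finset.univ.inf fun t => wt a s t + mwt w t r

theorem mwt_le_runWeight (ρ : List (Γ × S)) (s : S) :
    mwt wt (ρ.map Prod.fst) s (runEnd s ρ) ≤ runWeight wt s ρ := by
  induction ρ generalizing s with
  | nil => simp [mwt, runEnd, runWeight]
  | cons x ρ ih =>
    obtain ⟨a, t⟩ := x
    simp only [List.map_cons, mwt, runEnd, runWeight]
    exact (Finset.inf_le (Finset.mem_univ t)).trans (by gcongr; exact ih t)

theorem exists_runWeight_eq_mwt (w : List Γ) (s r : S) (h : mwt wt w s r ≠ ⊤) :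
    ∃ ρ : List (Γ × S), ρ.map Prod.fst = w ∧ runEnd s ρ = r ∧ runWeight wt s ρ = mwt wt w s r := by
  induction w generalizing s with
  | nil =>
    refine ⟨[], rfl, ?_⟩
    by_cases hs : s = r
    · simp [mwt, runEnd, runWeight, hs]
    · simp [mwt, hs] at h
  | cons a w ih =>
    obtain ⟨t, -, ht⟩ := Finset.exists_mem_eq_inf (Finset.univ : Finset S) ⟨s, Finset.mem_univ s⟩
      (fun t => wt a s t + mwt wt w t r)
    have h2 : mwt wt w t r ≠ ⊤ := by
      intro h3
      apply h
      simp only [mwt]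
      rw [ht, h3, add_top]
    obtain ⟨ρ, h4, h5, h6⟩ := ih t h2
    refine ⟨(a, t) :: ρ, by simp [h4], by simpa [runEnd] using h5, ?_⟩
    simp only [runWeight, mwt]
    rw [h6, ht]

/-- The minimal weight of a run on `w` from `s` to any state. -/
def mwtAny (w : List Γ) (s : S) : Weight := Finset.univ.inf fun r => mwt wt w s r

/-- The states reachable from the set `B` by reading `w`. -/
def reach (B : Set S) (w : List Γ) : Set S := {r | ∃ s ∈ B, mwt wt w s r ≠ ⊤}

/-- The configuration reached from the state `s` by reading `w`, i.e. from the configuration that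
assigns `0` to `s` and infinity to all other states. -/
def xconf (s : S) (w : List Γ) : S → Weight := fun q => mwt wt w s q

/-- The reflexive states of `(B, w)`. -/
def refStates (B : Set S) (w : List Γ) : Set S := {s | s ∈ B ∧ mwt wt w s s ≠ ⊤}

/-- The minimal reflexive states of `(B, w)`. -/
def minStates (B : Set S) (w : List Γ) : Set S :=
  {s | s ∈ refStates wt B w ∧ ∀ r ∈ refStates wt B w, mwt wt w s s ≤ mwt wt w r r}

/-- `(s, r)` is a grounded pair of `(B, w)`. -/
def Grounded (B : Set S) (w : List Γ) (s r : S) : Prop :=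
  s ∈ B ∧ r ∈ B ∧ ∃ g ∈ minStates wt B (wpow w (bigM S)),
    mwt wt (wpow w (bigM S)) s g ≠ ⊤ ∧ mwt wt (wpow w (bigM S)) g r ≠ ⊤

open Classical in
/-- The weights of the transitions on the stabilisation of `(B, w)`: for a grounded pair, the
minimal weight of a run `s → g → r` on `w ^ m`, `w ^ m` through a minimal reflexive state `g`;
infinity for all other pairs. -/
noncomputable def stabWeight (B : Set S) (w : List Γ) (s r : S) : Weight :=
  if Grounded wt B w s r then
    (Finset.univ.filter fun g => g ∈ minStates wt B (wpow w (bigM S))).inf fun g =>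
      mwt wt (wpow w (bigM S)) s g + mwt wt (wpow w (bigM S)) g r
  else ⊤

/-- The cycle `(B, w)` is degenerate. -/
def Degenerate (B : Set S) (w : List Γ) : Prop :=
  ∀ s ∈ B, ∀ t ∈ refStates wt B (wpow w (2 * bigM S)),
    (∃ k, 1 ≤ k ∧ mwt wt (wpow w (2 * bigM S * k)) s t ≠ ⊤) → Grounded wt B w s t

/-- The maximal absolute value of a finite weight of a transition on the letter `a`
(`0` if there is none). -/
def wmax (a : Γ) : ℕ :=
  Finset.univ.sup fun p => Finset.univ.sup fun q => ((wt a p q).untopD 0).natAbs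

/-- The maximal effect of a word. -/
def maxeff (w : List Γ) : ℕ := (w.map (wmax wt)).sum

/-- `M₀` is an unfolding constant of the stable cycle `(B, w)` for the bound `F`: after every
number `2 * m * k` of repetitions of `w` with `k ≥ M₀`, the non-grounded pairs have weight above
`F` and the grounded pairs have the weight of the stabilisation of `(B, w)`. -/
def IsUnfoldingConstant (B : Set S) (w : List Γ) (F M₀ : ℕ) : Prop :=
  ∀ k, M₀ ≤ k → ∀ s ∈ B, ∀ r ∈ B,
    (¬ Grounded wt B w s r → (((F : ℤ) : Weight) < mwt wt (wpow w (2 * bigM S * k)) s r)) ∧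
    (Grounded wt B w s r → mwt wt (wpow w (2 * bigM S * k)) s r = stabWeight wt B w s r)

end General

/-- A (min,+) weighted automaton with states `Q` and alphabet `Sig`. For all `p`, `σ`, `q` there is
exactly one transition from `p` to `q` on `σ`, of weight `wt p σ q`. -/
structure WFA (Q Sig : Type*) where
  init : Q
  wt : Q → Sig → Q → Weight

/-- The states of the baseline-augmented automaton: triples `(q, p, T)` with `q, p ∈ T`. -/
abbrev AugState (Q : Type*) := {s : Q × Q × Finset Q // s.1 ∈ s.2.2 ∧ s.2.1 ∈ s.2.2}

namespace AugState

variable {Q : Type*}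

/-- The inner state `q` of `(q, p, T)`. -/
def inner (s : AugState Q) : Q := s.1.1

/-- The baseline component `p` of `(q, p, T)`. -/
def base (s : AugState Q) : Q := s.1.2.1

/-- The reachable subset `T` of `(q, p, T)`. -/
def rset (s : AugState Q) : Finset Q := s.1.2.2

/-- Baseline states: `(p, p, T)`. -/
def IsBaseline (s : AugState Q) : Prop := s.inner = s.base

/-- The states agree on the last two components. -/
def SameFrame (s t : AugState Q) : Prop := s.base = t.base ∧ s.rset = t.rset

/-- For `t = (q', p', T)` and `s = (q, p, T)`, the state `(q', p, T)`. -/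
def withBase (t s : AugState Q) (h : t.rset = s.rset) : AugState Q :=
  ⟨(t.inner, s.base, s.rset), by
    constructor
    · change t.inner ∈ s.rset
      rw [← h]; exact t.2.1
    · exact s.2.2⟩

end AugState

/-- The letters of the cactus extension: transitions `(p, σ, c, q)` of the original automaton (`c`
is determined by the other components), cactus letters, rebase letters and jump letters. This is
the type of all formal letters; the alphabets below carve out the legitimate ones. -/
inductive Letter (Q Sig : Type*)
  | base (p : Q) (σ : Sig) (q : Q)
  | cactus (B : Set (AugState Q)) (w : List (Letter Q Sig))
  | rebase (B : Set (AugState Q)) (w : List (Letter Q Sig)) (s r : AugState Q)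
  | jump (s r : AugState Q)

section Cactus

variable {Q Sig : Type*}

mutual
  /-- The depth of a letter. Depth plays no role for jump letters. -/
  def dep : Letter Q Sig → ℕ
    | .base _ _ _ => 0
    | .cactus _ w => 1 + depWord w
    | .rebase _ w _ _ => 1 + depWord w
    | .jump _ _ => 0
  /-- The depth of a word: the maximal depth of its letters. -/
  def depWord : List (Letter Q Sig) → ℕ
    | [] => 0
    | a :: w => max (dep a) (depWord w)
end

variable [Fintype Q] [DecidableEq Q] (A : WFA Q Sig)

open Classical in
/-- The set of states reachable from `T` on the letter `σ` of the original automaton. -/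
noncomputable def WFA.step (T : Finset Q) (σ : Sig) : Finset Q :=
  Finset.univ.filter fun q => ∃ p ∈ T, A.wt p σ q ≠ ⊤

/-- The initial state `(q₀, q₀, {q₀})` of the baseline-augmented automaton. -/
def WFA.augInit : AugState Q := ⟨(A.init, A.init, {A.init}), by simp⟩

open Classical in
/-- The transitions of the baseline-augmented automaton on `(p, σ, c, q)`: if `c` is finite, there
is a transition `(p₁, p, T₁) → (p₂, q, δ(T₁, σ))` of weight `c' - c`, where `c'` is the weight of
the transition `p₁ → p₂` on `σ`. -/
noncomputable def baseWeight (p : Q) (σ : Sig) (q : Q) (s t : AugState Q) : Weight :=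
  if A.wt p σ q ≠ ⊤ ∧ s.base = p ∧ t.base = q ∧ t.rset = A.step s.rset σ then
    wsub (A.wt s.inner σ t.inner) (A.wt p σ q)
  else ⊤

open Classical in
/-- The transitions of a rebase letter for the pair `s = (q₁, p, T)`, `r = (q₂, p, T)`, where `cw`
are the weights of the underlying cactus letter: a transition `(q', p, T) → (q'', p, T)` of weight
`d` on the cactus letter gives a transition `(q', q₁, T) → (q'', q₂, T)` of weight
`d - cw s r`. -/
noncomputable def rebaseWeight (cw : AugState Q → AugState Q → Weight) (s r t t' : AugState Q) :
    Weight :=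
  if h : t.rset = s.rset ∧ t'.rset = s.rset ∧ t.base = s.inner ∧ t'.base = r.inner then
    wsub (cw (t.withBase s h.1) (t'.withBase s h.2.1)) (cw s r)
  else ⊤

/-- The transitions of the jump letter for `s = (q, p₁, T)`, `r = (q, p₂, T)`: transitions
`(q', p₁, T) → (q', p₂, T)` of weight `0`. -/
def jumpWeight (s r t t' : AugState Q) : Weight :=
  if t.rset = s.rset ∧ t.base = s.base ∧ t'.rset = r.rset ∧ t'.base = r.base ∧
      t'.inner = t.inner then 0 else ⊤

mutual
  /-- The transition weights of all letters. For a cactus letter these are the stabilisation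
  weights of its inner word (whose letters are represented here by their own transition matrices,
  see `lw_cactus`). -/
  noncomputable def lw : Letter Q Sig → AugState Q → AugState Q → Weight
    | .base p σ q => baseWeight A p σ q
    | .cactus B w => stabWeight id B (lwWord w)
    | .rebase B w s r => rebaseWeight (stabWeight id B (lwWord w)) s r
    | .jump s r => jumpWeight s r
  /-- The list of the transition matrices of the letters of a word. -/
  noncomputable def lwWord : List (Letter Q Sig) → List (AugState Q → AugState Q → Weight)
    | [] => []
    | a :: w => lw a :: lwWord w
end

theorem lwWord_eq_map (w : List (Letter Q Sig)) : lwWord A w = w.map (lw A) := by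
  induction w with
  | nil => rfl
  | cons a w ih => simp only [lwWord, List.map_cons, ih]

theorem mwt_map {Γ S : Type*} [Fintype S] [DecidableEq S] (wt : Γ → S → S → Weight) (w : List Γ) :
    mwt id (w.map wt) = mwt wt w := by
  induction w with
  | nil => rfl
  | cons a w ih => funext s r; simp only [List.map_cons, mwt, ih, id]

theorem stabWeight_map {Γ S : Type*} [Fintype S] [DecidableEq S] (wt : Γ → S → S → Weight)
    (B : Set S) (w : List Γ) : stabWeight id B (w.map wt) = stabWeight wt B w := by
  have h (n : ℕ) : wpow (w.map wt) n = (wpow w n).map wt := by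
    simp [wpow, List.map_flatten]
  have h1 (n : ℕ) : minStates id B (wpow (w.map wt) n) = minStates wt B (wpow w n) := by
    simp only [minStates, refStates, h, mwt_map]
  have h2 : Grounded id B (w.map wt) = Grounded wt B w := by
    funext s r
    unfold Grounded
    simp only [h1]
    simp only [h, mwt_map]
  funext s r
  unfold stabWeight
  rw [h1, h2, h, mwt_map]

theorem lw_cactus (B : Set (AugState Q)) (w : List (Letter Q Sig)) :
    lw A (.cactus B w) = stabWeight (lw A) B w := by
  rw [lw, lwWord_eq_map, stabWeight_map]

theorem lw_rebase (B : Set (AugState Q)) (w : List (Letter Q Sig)) (s r : AugState Q) :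
    lw A (.rebase B w s r) = rebaseWeight (lw A (.cactus B w)) s r := by
  simp only [lw]

/-- `(B, w)` is a reflexive cycle with baseline state `s = (q, q, T)`: `B` consists of all states
`(p, q, T)` with `p ∈ T`, and reading `w` from `B` leads back to `B`. -/
def IsReflexiveCycle (B : Set (AugState Q)) (w : List (Letter Q Sig)) (s : AugState Q) : Prop :=
  s.IsBaseline ∧ B = {t | t.SameFrame s} ∧ reach (lw A) B w ⊆ B

/-- `(B, w)` is a stable cycle: for every `n`, the baseline state is minimal reflexive for `w ^ n`
and its minimal cycles on `w ^ n` have weight `0`. -/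
def IsStableCycle (B : Set (AugState Q)) (w : List (Letter Q Sig)) : Prop :=
  ∃ s, IsReflexiveCycle A B w s ∧
    ∀ n : ℕ, s ∈ minStates (lw A) B (wpow w n) ∧ mwt (lw A) (wpow w n) s s = 0

/-- The letters of all depths that are, hereditarily, either letters of the baseline-augmented
automaton or cactus letters of non-degenerate stable cycles `(B, w)`, where the length of `w` is at
most the value of `L` at the depth of the cactus letter. -/
inductive LengthBounded (L : ℕ → ℕ) : Letter Q Sig → Prop
  | base (p : Q) (σ : Sig) (q : Q) : LengthBounded L (.base p σ q)
  | cactus (B : Set (AugState Q)) (w : List (Letter Q Sig)) :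
      (∀ a ∈ w, LengthBounded L a) → IsStableCycle A B w → ¬ Degenerate (lw A) B w →
      w.length ≤ L (dep (Letter.cactus B w)) → LengthBounded L (.cactus B w)

/-- The `L`-bounded cactus letters of depth `k`. -/
def boundedCacti (L : ℕ → ℕ) (k : ℕ) : Set (Letter Q Sig) := {a | LengthBounded A L a ∧ dep a = k}

/-- The `L`-bounded cactus letters: those of depths `0, …, |S| - 1`. -/
def boundedCac (L : ℕ → ℕ) : Set (Letter Q Sig) :=
  {a | ∃ k < Fintype.card (AugState Q), a ∈ boundedCacti A L k}

/-- The `L`-bounded cactus letters with their rebase letters. -/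
def boundedCacReb (L : ℕ → ℕ) : Set (Letter Q Sig) :=
  boundedCac A L ∪
    {a | ∃ B w s r, Letter.cactus B w ∈ boundedCac A L ∧ Grounded (lw A) B w s r ∧
      a = .rebase B w s r}

/-- The cactus letters that are a single stabilisation of a word over `boundedCacReb`. -/
def boundedCacRebCac (L : ℕ → ℕ) : Set (Letter Q Sig) :=
  {a | ∃ B w, (∀ b ∈ w, b ∈ boundedCacReb A L) ∧ IsStableCycle A B w ∧
    w.length ≤ L (depWord w + 1) ∧ a = .cactus B w}

/-- The jump letters, one for all `s = (q, p₁, T)` and `r = (q, p₂, T)`. -/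
def jumpLetters : Set (Letter Q Sig) :=
  {a | ∃ s r : AugState Q, s.inner = r.inner ∧ s.rset = r.rset ∧ a = .jump s r}

/-- `boundedCacReb` together with the jump letters. -/
def boundedCacRebJump (L : ℕ → ℕ) : Set (Letter Q Sig) := boundedCacReb A L ∪ jumpLetters

/-- The suffixes used for dominance and witnesses: words over the alphabet with rebase and jump
letters for the simple bound `Ls`, followed by one letter of `boundedCacRebCac` for the general
bound `Lg`. -/
def IsSuffix (Ls Lg : ℕ → ℕ) (z : List (Letter Q Sig)) : Prop :=
  ∃ y a, (∀ b ∈ y, b ∈ boundedCacRebJump A Ls) ∧ a ∈ boundedCacRebCac A Lg ∧ z = y ++ [a]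

/-- The ghost-reachable states from `s` upon reading `w`: all states that share their last two
components with a state reachable from `s`. -/
def ghostReach (s : AugState Q) (w : List (Letter Q Sig)) : Set (AugState Q) :=
  {t | ∃ r ∈ reach (lw A) {s} w, t.SameFrame r}

/-- The state `q` in the support of the configuration `c` is dominant: some suffix can be read from
`q` but from none of the states below `q`. -/
def IsDominant (Ls Lg : ℕ → ℕ) (c : AugState Q → Weight) (q : AugState Q) : Prop :=
  c q ≠ ⊤ ∧ ∃ z, IsSuffix A Ls Lg z ∧ mwtAny (lw A) z q ≠ ⊤ ∧
    ∀ p, c p < c q → mwtAny (lw A) z p = ⊤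

/-- `w` has a seamless baseline run: a run from the initial state, all of whose states are baseline
states, such that each of its prefixes has minimal weight among the runs on the same word from the
initial state to the same state. -/
def HasSeamlessBaselineRun (w : List (Letter Q Sig)) : Prop :=
  ∃ ρ : List (Letter Q Sig × AugState Q), ρ.map Prod.fst = w ∧
    runWeight (lw A) A.augInit ρ ≠ ⊤ ∧
    (∀ x ∈ ρ, x.2.IsBaseline) ∧
    ∀ j ≤ ρ.length, runWeight (lw A) A.augInit (ρ.take j) =
      mwt (lw A) (w.take j) A.augInit (runEnd A.augInit (ρ.take j))

/-- `w` contains no jump letter. -/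
def JumpFree (w : List (Letter Q Sig)) : Prop := ∀ s r : AugState Q, Letter.jump s r ∉ w

/-- The potential of `w` is defined and equal to `P`: `w` is jump-free and has a seamless baseline
run, and `P` is the maximal weight of a dominant state in the configuration after reading `w`. -/
def HasPotential (Ls Lg : ℕ → ℕ) (w : List (Letter Q Sig)) (P : ℤ) : Prop :=
  JumpFree w ∧ HasSeamlessBaselineRun A w ∧
    (∃ q, IsDominant A Ls Lg (xconf (lw A) A.augInit w) q ∧
      xconf (lw A) A.augInit w q = (P : Weight)) ∧
    ∀ q, IsDominant A Ls Lg (xconf (lw A) A.augInit w) q →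
      xconf (lw A) A.augInit w q ≤ (P : Weight)

/-- `(w₁, α, w₃)` with the cactus letter `α` for `(B, w₂)` is a witness of type 0. -/
def IsTypeZeroWitness (Ls Lg : ℕ → ℕ) (w₁ : List (Letter Q Sig)) (B : Set (AugState Q))
    (w₂ w₃ : List (Letter Q Sig)) : Prop :=
  (∀ a ∈ w₁, a ∈ boundedCac A Ls) ∧
  B = ghostReach A A.augInit w₁ ∧
  Letter.cactus B w₂ ∈ boundedCac A Ls ∧
  IsSuffix A Ls Lg w₃ ∧
  reach (lw A) {A.augInit} w₁ =
    reach (lw A) {A.augInit} (w₁ ++ wpow w₂ (2 * bigM (AugState Q))) ∧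
  mwtAny (lw A) (w₁ ++ wpow w₂ (2 * bigM (AugState Q)) ++ w₃) A.augInit ≠ ⊤ ∧
  mwtAny (lw A) (w₁ ++ Letter.cactus B w₂ :: w₃) A.augInit = ⊤

end Cactus

end CactusWFA

open CactusWFA

-- Write `m` for `bigM`. Cycles on powers of `x` inside a stable cycle `(B, x)` have nonnegative
-- weight, so for an optimal run on `x ^ (2 m k)` there are two cases. Either cutting out cycles
-- meets a state with a zero-weight cycle; such a cycle can be taken of length at most `|S|`, hence
-- repeated to length `|S|!`, and the run is then no cheaper than one counted by the stabilisation.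
-- Or every cycle cut out costs at least 1, and the weight grows linearly in `k`. This yields the
-- unfolding constant (`NonnegCycles.zero_cycle_or_le`, `NonnegCycles.exists_isUnfoldingConstant`).
--
-- Since `F` is at least twice the maximal effect, unfolding keeps every finite weight of the
-- configuration and can only turn infinite weights into values above all the old finite ones
-- (`IsUnfoldingConstant.mwt_eq_or`). This needs `u` to lead from the initial state into `B`, which
-- is where readability of the cactus letter enters.
--
-- Hence old dominant states stay dominant: newcomers lie above them. If a newcomer is dominant
-- through a suffix `z`, then `z` is blocked at all old states, so `v z` is readable after the
-- unfolding but not after the cactus letter. This gives a type-0 witness with prefix `u x ^ (2 m)`,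
-- because reachability on `x ^ (2 m k)` is the same for all `k ≥ 1`.
--
-- For seamless runs, a word over standard and cactus letters determines the last two components of
-- the state, and baseline runs have weight 0. Seamlessness thus amounts to readability plus
-- nonnegative weights of baseline states after each prefix (`hasSeamlessBaselineRun_iff`), and this
-- condition transfers both ways.

namespace CactusWFA

-- Minimal weights on concatenations and powers

section General

variable {Γ S : Type*} [Fintype S] [DecidableEq S] (wt : Γ → S → S → Weight)

theorem wpow_zero (w : List Γ) : wpow w 0 = [] := rfl

theorem wpow_succ (w : List Γ) (n : ℕ) : wpow w (n + 1) = w ++ wpow w n := by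
  simp [wpow, List.replicate_succ]

theorem wpow_add (w : List Γ) (a b : ℕ) : wpow w (a + b) = wpow w a ++ wpow w b := by
  rw [wpow, List.replicate_add, List.flatten_append, wpow, wpow]

theorem wpow_one (w : List Γ) : wpow w 1 = w := by simp [wpow]

theorem wpow_wpow (w : List Γ) (a b : ℕ) : wpow (wpow w a) b = wpow w (a * b) := by
  induction b with
  | zero => rfl
  | succ b ih => rw [wpow_succ, ih, Nat.mul_succ, Nat.add_comm, wpow_add]

theorem mem_of_mem_wpow {w : List Γ} {n : ℕ} {a : Γ} (h : a ∈ wpow w n) : a ∈ w := by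
  simp only [wpow, List.mem_flatten, List.mem_replicate] at h
  obtain ⟨l, ⟨-, rfl⟩, h⟩ := h
  exact h

theorem mwt_nil_self (s : S) : mwt wt [] s s = 0 := by simp [mwt]

theorem eq_of_mwt_nil {s r : S} (h : mwt wt [] s r ≠ ⊤) : s = r := by
  by_contra h1
  simp [mwt, h1] at h

theorem mwt_cons_le (a : Γ) (w : List Γ) (s t r : S) :
    mwt wt (a :: w) s r ≤ wt a s t + mwt wt w t r :=
  Finset.inf_le (Finset.mem_univ t)

theorem exists_mwt_cons_eq (a : Γ) (w : List Γ) (s r : S) :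
    ∃ t, mwt wt (a :: w) s r = wt a s t + mwt wt w t r := by
  obtain ⟨t, -, ht⟩ := Finset.exists_mem_eq_inf (Finset.univ : Finset S) ⟨s, Finset.mem_univ s⟩
    (fun t => wt a s t + mwt wt w t r)
  exact ⟨t, ht⟩

theorem mwt_append_le (w₁ w₂ : List Γ) (s t r : S) :
    mwt wt (w₁ ++ w₂) s r ≤ mwt wt w₁ s t + mwt wt w₂ t r := by
  induction w₁ generalizing s with
  | nil =>
    by_cases h : s = t
    · subst h; simp [mwt]
    · simp [mwt, h]
  | cons a w₁ ih =>
    obtain ⟨p, hp⟩ := exists_mwt_cons_eq wt a w₁ s t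
    rw [hp, List.cons_append, add_assoc]
    exact (mwt_cons_le wt a _ s p r).trans (by gcongr; exact ih p)

theorem exists_mwt_append_eq (w₁ w₂ : List Γ) (s r : S) :
    ∃ t, mwt wt (w₁ ++ w₂) s r = mwt wt w₁ s t + mwt wt w₂ t r := by
  induction w₁ generalizing s with
  | nil => exact ⟨s, by simp [mwt]⟩
  | cons a w₁ ih =>
    obtain ⟨p, hp⟩ := exists_mwt_cons_eq wt a (w₁ ++ w₂) s r
    obtain ⟨t, ht⟩ := ih p
    refine ⟨t, le_antisymm (mwt_append_le wt _ _ _ _ _) ?_⟩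
    rw [List.cons_append, hp, ht, ← add_assoc]
    gcongr
    exact mwt_cons_le wt a w₁ s p t

theorem mwt_singleton (a : Γ) (s r : S) : mwt wt [a] s r = wt a s r := by
  refine le_antisymm ((mwt_cons_le wt a [] s r r).trans (by simp [mwt])) ?_
  obtain ⟨t, ht⟩ := exists_mwt_cons_eq wt a [] s r
  rw [ht]
  by_cases h : t = r
  · subst h; simp [mwt]
  · simp [mwt, h]

theorem mwt_append_ne_top {w₁ w₂ : List Γ} {s t r : S} (h₁ : mwt wt w₁ s t ≠ ⊤)
    (h₂ : mwt wt w₂ t r ≠ ⊤) : mwt wt (w₁ ++ w₂) s r ≠ ⊤ :=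
  ne_top_of_le_ne_top (WithTop.add_ne_top.2 ⟨h₁, h₂⟩) (mwt_append_le wt w₁ w₂ s t r)

theorem exists_of_mwt_append_ne_top {w₁ w₂ : List Γ} {s r : S} (h : mwt wt (w₁ ++ w₂) s r ≠ ⊤) :
    ∃ t, mwt wt w₁ s t ≠ ⊤ ∧ mwt wt w₂ t r ≠ ⊤ := by
  obtain ⟨t, ht⟩ := exists_mwt_append_eq wt w₁ w₂ s r
  rw [ht, WithTop.add_ne_top] at h
  exact ⟨t, h⟩

theorem exists_of_mwt_cons_ne_top {a : Γ} {w : List Γ} {s r : S} (h : mwt wt (a :: w) s r ≠ ⊤) :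
    ∃ t, wt a s t ≠ ⊤ ∧ mwt wt w t r ≠ ⊤ := by
  obtain ⟨t, ht⟩ := exists_mwt_cons_eq wt a w s r
  rw [ht, WithTop.add_ne_top] at h
  exact ⟨t, h⟩

theorem mwtAny_ne_top {w : List Γ} {s : S} : mwtAny wt w s ≠ ⊤ ↔ ∃ r, mwt wt w s r ≠ ⊤ := by
  simp [mwtAny, Finset.inf_eq_top_iff]

theorem mwtAny_append_ne_top {w₁ w₂ : List Γ} {s : S} :
    mwtAny wt (w₁ ++ w₂) s ≠ ⊤ ↔ ∃ t, mwt wt w₁ s t ≠ ⊤ ∧ mwtAny wt w₂ t ≠ ⊤ := by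
  simp only [mwtAny_ne_top]
  constructor
  · rintro ⟨r, hr⟩
    obtain ⟨t, h1, h2⟩ := exists_of_mwt_append_ne_top wt hr
    exact ⟨t, h1, r, h2⟩
  · rintro ⟨t, h1, r, h2⟩
    exact ⟨r, mwt_append_ne_top wt h1 h2⟩

theorem natAbs_le_wmax {a : Γ} {p q : S} {c : ℤ} (h : wt a p q = c) : c.natAbs ≤ wmax wt a := by
  have h1 : ((wt a p q).untopD 0).natAbs ≤ wmax wt a :=
    (Finset.le_sup (f := fun q => ((wt a p q).untopD 0).natAbs) (Finset.mem_univ q)).trans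
      (Finset.le_sup (f := fun p => Finset.univ.sup fun q => ((wt a p q).untopD 0).natAbs)
        (Finset.mem_univ p))
  simpa [h] using h1

theorem natAbs_le_maxeff {w : List Γ} {s r : S} {c : ℤ} (h : mwt wt w s r = c) :
    c.natAbs ≤ maxeff wt w := by
  induction w generalizing s c with
  | nil =>
    have := eq_of_mwt_nil wt (s := s) (r := r) (by simp [h])
    subst this
    rw [mwt_nil_self] at h
    have : c = 0 := by exact_mod_cast h.symm
    simp [this]
  | cons a w ih =>
    obtain ⟨t, ht⟩ := exists_mwt_cons_eq wt a w s r
    have h1 : wt a s t + mwt wt w t r ≠ ⊤ := by rw [← ht, h]; simp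
    rw [WithTop.add_ne_top] at h1
    obtain ⟨c₁, hc₁⟩ := WithTop.ne_top_iff_exists.1 h1.1
    obtain ⟨c₂, hc₂⟩ := WithTop.ne_top_iff_exists.1 h1.2
    have h2 := natAbs_le_wmax wt hc₁.symm
    have h3 := ih hc₂.symm
    rw [h, ← hc₁, ← hc₂] at ht
    have h4 : c = c₁ + c₂ := by exact_mod_cast ht
    simp only [maxeff, List.map_cons, List.sum_cons] at h3 ⊢
    omega

theorem maxeff_append (w₁ w₂ : List Γ) : maxeff wt (w₁ ++ w₂) = maxeff wt w₁ + maxeff wt w₂ := by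
  simp [maxeff]

theorem maxeff_cons (a : Γ) (w : List Γ) : maxeff wt (a :: w) = wmax wt a + maxeff wt w := by
  simp [maxeff]

theorem maxeff_wpow (w : List Γ) (n : ℕ) : maxeff wt (wpow w n) = n * maxeff wt w := by
  induction n with
  | zero => simp [wpow_zero, maxeff]
  | succ n ih => rw [wpow_succ, maxeff_append, ih]; ring

theorem maxeff_le_of_prefix {w₁ w₂ : List Γ} (h : w₁ <+: w₂) : maxeff wt w₁ ≤ maxeff wt w₂ := by
  obtain ⟨t, rfl⟩ := h
  rw [maxeff_append]
  omega

theorem mem_of_mwt_wpow_ne_top {B : Set S} {w : List Γ} (hB : reach wt B w ⊆ B) {n : ℕ} {s r : S}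
    (hs : s ∈ B) (h : mwt wt (wpow w n) s r ≠ ⊤) : r ∈ B := by
  induction n generalizing s with
  | zero => exact eq_of_mwt_nil wt h ▸ hs
  | succ n ih =>
    rw [wpow_succ] at h
    obtain ⟨t, h1, h2⟩ := exists_of_mwt_append_ne_top wt h
    exact ih (hB ⟨s, hs, h1⟩) h2

/-- The states on an optimal run on `w ^ n`, after each copy of `w`. -/
theorem exists_optimal_path {w : List Γ} {n : ℕ} {s r : S} (h : mwt wt (wpow w n) s r ≠ ⊤) :
    ∃ p : ℕ → S, p 0 = s ∧ p n = r ∧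
      ∑ i ∈ Finset.range n, mwt wt w (p i) (p (i + 1)) = mwt wt (wpow w n) s r := by
  induction n generalizing s with
  | zero =>
    have := eq_of_mwt_nil wt h
    subst this
    exact ⟨fun _ => s, rfl, rfl, by simp [wpow_zero, mwt]⟩
  | succ n ih =>
    rw [wpow_succ] at h ⊢
    obtain ⟨t, ht⟩ := exists_mwt_append_eq wt w (wpow w n) s r
    rw [ht, WithTop.add_ne_top] at h
    obtain ⟨p, h0, hn, hp⟩ := ih h.2
    refine ⟨fun i => Nat.casesOn i s p, rfl, hn, ?_⟩
    rw [Finset.sum_range_succ', add_comm, ht, ← hp]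
    simp [h0]

theorem mwt_le_sum_path (w : List Γ) (p : ℕ → S) (i n : ℕ) :
    mwt wt (wpow w n) (p i) (p (i + n)) ≤
      ∑ j ∈ Finset.Ico i (i + n), mwt wt w (p j) (p (j + 1)) := by
  induction n with
  | zero => simp [wpow_zero, mwt]
  | succ n ih =>
    rw [← Nat.add_assoc, Finset.sum_Ico_succ_top (by omega), wpow_add, wpow_one]
    exact (mwt_append_le wt _ _ _ (p (i + n)) _).trans (by gcongr)

/-- An optimal run on `w ^ n`, where `n` is at least the number of states, contains a cycle. -/
theorem exists_cycle {w : List Γ} {n : ℕ} {s r : S} (hn : Fintype.card S ≤ n)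
    (h : mwt wt (wpow w n) s r ≠ ⊤) :
    ∃ a l b p, a + l + b = n ∧ 1 ≤ l ∧ l ≤ Fintype.card S ∧
      mwt wt (wpow w a) s p + mwt wt (wpow w l) p p + mwt wt (wpow w b) p r ≤
        mwt wt (wpow w n) s r := by
  obtain ⟨p, rfl, rfl, hp⟩ := exists_optimal_path wt h
  obtain ⟨i, j, hij, hpij⟩ := Fintype.exists_ne_map_eq_of_card_lt
    (fun i : Fin (Fintype.card S + 1) => p i) (by simp)
  wlog hlt : i < j generalizing i j
  · exact this j i hij.symm hpij.symm (lt_of_le_of_ne (not_lt.1 hlt) hij.symm)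
  have hi := i.2
  have hj := j.2
  have hlt' : (i : ℕ) < j := hlt
  obtain ⟨l, hl⟩ := Nat.exists_eq_add_of_le hlt'.le
  obtain ⟨b, hb⟩ := Nat.exists_eq_add_of_le (show (j : ℕ) ≤ n by omega)
  refine ⟨i, l, b, p i, by omega, by omega, by omega, ?_⟩
  have h1 := mwt_le_sum_path wt w p 0 i
  have h2 := mwt_le_sum_path wt w p i l
  have h3 := mwt_le_sum_path wt w p j b
  simp only [Nat.zero_add] at h1
  rw [← hl] at h2
  rw [← hb] at h3
  rw [← hpij] at h2 h3
  rw [← hp, Finset.range_eq_Ico, ← Finset.sum_Ico_consecutive _ (Nat.zero_le i) (by omega),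
    ← Finset.sum_Ico_consecutive _ (show (i : ℕ) ≤ j by omega) (by omega), ← add_assoc]
  gcongr

theorem mwt_wpow_self_le_zero {w : List Γ} {s : S} (h : mwt wt w s s ≤ 0) (n : ℕ) :
    mwt wt (wpow w n) s s ≤ 0 := by
  induction n with
  | zero => simp [wpow_zero, mwt]
  | succ n ih =>
    rw [wpow_succ]
    exact (mwt_append_le wt _ _ _ s _).trans (add_nonpos h ih)

theorem mwt_wpow_self_ne_top {w : List Γ} {s : S} (h : mwt wt w s s ≠ ⊤) (n : ℕ) :
    mwt wt (wpow w n) s s ≠ ⊤ := by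
  induction n with
  | zero => simp [wpow_zero, mwt]
  | succ n ih =>
    rw [wpow_succ]
    exact mwt_append_ne_top wt h ih

-- Cutting and padding runs when all cycles are nonnegative

/-- `B` is closed under reading `w` and all its cycles on powers of `w` have nonnegative weight. -/
structure NonnegCycles (B : Set S) (w : List Γ) : Prop where
  closed : reach wt B w ⊆ B
  nonneg : ∀ n, ∀ p ∈ B, 0 ≤ mwt wt (wpow w n) p p

variable {wt} {B : Set S} {w : List Γ}

theorem NonnegCycles.pow (h : NonnegCycles wt B w) (N : ℕ) : NonnegCycles wt B (wpow w N) where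
  closed := by
    rintro r ⟨s, hs, hr⟩
    exact mem_of_mwt_wpow_ne_top wt h.closed hs hr
  nonneg n p hp := by
    rw [wpow_wpow]
    exact h.nonneg _ p hp

/-- Cutting a cycle out of an optimal run. -/
theorem NonnegCycles.exists_shorter (h : NonnegCycles wt B w) {n : ℕ} {s r : S} (hs : s ∈ B)
    (hn : Fintype.card S ≤ n) (hr : mwt wt (wpow w n) s r ≠ ⊤) :
    ∃ n' < n, n ≤ n' + Fintype.card S ∧
      mwt wt (wpow w n') s r ≤ mwt wt (wpow w n) s r := by
  obtain ⟨a, l, b, p, h1, h2, h3, h4⟩ := exists_cycle wt hn hr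
  have h5 := ne_top_of_le_ne_top hr h4
  rw [WithTop.add_ne_top, WithTop.add_ne_top] at h5
  have hp := mem_of_mwt_wpow_ne_top wt h.closed hs h5.1.1
  refine ⟨a + b, by omega, by omega, ?_⟩
  rw [wpow_add]
  refine (mwt_append_le wt _ _ _ p _).trans (le_trans ?_ h4)
  gcongr
  exact le_add_of_nonneg_right (h.nonneg l p hp)

theorem NonnegCycles.exists_short (h : NonnegCycles wt B w) (n : ℕ) {s r : S} (hs : s ∈ B)
    (hr : mwt wt (wpow w n) s r ≠ ⊤) :
    ∃ n' < Fintype.card S,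
      mwt wt (wpow w n') s r ≤ mwt wt (wpow w n) s r := by
  induction n using Nat.strong_induction_on with
  | _ n ih =>
    by_cases hn : n < Fintype.card S
    · exact ⟨n, hn, le_rfl⟩
    obtain ⟨n₁, h1, -, h2⟩ := h.exists_shorter hs (not_lt.1 hn) hr
    obtain ⟨n₂, h3, h4⟩ := ih n₁ h1 (ne_top_of_le_ne_top hr h2)
    exact ⟨n₂, h3, h4.trans h2⟩

/-- A state on a cycle of weight `0` is on a cycle of weight `0` of length at most `|S|`. -/
theorem NonnegCycles.exists_short_cycle (h : NonnegCycles wt B w) (n : ℕ) (hn : 1 ≤ n) {g : S}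
    (hg : g ∈ B) (h0 : mwt wt (wpow w n) g g ≤ 0) :
    ∃ l, 1 ≤ l ∧ l ≤ Fintype.card S ∧ mwt wt (wpow w l) g g ≤ 0 := by
  induction n using Nat.strong_induction_on with
  | _ n ih =>
    by_cases hn' : n ≤ Fintype.card S
    · exact ⟨n, hn, hn', h0⟩
    -- The first copy of `w` is set aside and the cut is made in the other `k`: this keeps `g` as
    -- base point and the length positive.
    obtain ⟨k, rfl⟩ := Nat.exists_eq_add_of_le' hn
    have h1 : mwt wt (wpow w (k + 1)) g g ≠ ⊤ :=
      ne_top_of_le_ne_top WithTop.zero_ne_top h0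
    rw [wpow_succ] at h0 h1
    obtain ⟨t, ht⟩ := exists_mwt_append_eq wt w (wpow w k) g g
    rw [ht, WithTop.add_ne_top] at h1
    obtain ⟨k', h2, -, h3⟩ :=
      h.exists_shorter (h.closed ⟨g, hg, h1.1⟩) (by omega : Fintype.card S ≤ k) h1.2
    refine ih (k' + 1) (by omega) (by omega) ?_
    rw [wpow_succ]
    refine (mwt_append_le wt _ _ _ t _).trans (le_trans ?_ (ht ▸ h0))
    gcongr

/-- Every length up to `|S|` divides `|S|!`, so one exponent serves all states on zero cycles. -/
theorem NonnegCycles.factorial_cycle (h : NonnegCycles wt B w) (n : ℕ) (hn : 1 ≤ n) {g : S}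
    (hg : g ∈ B) (h0 : mwt wt (wpow w n) g g ≤ 0) :
    mwt wt (wpow w (Fintype.card S).factorial) g g ≤ 0 := by
  obtain ⟨l, h1, h2, h3⟩ := h.exists_short_cycle n hn hg h0
  obtain ⟨c, hc⟩ := Nat.dvd_factorial (by omega) h2
  rw [hc, ← wpow_wpow]
  exact mwt_wpow_self_le_zero wt h3 c

/-- Cut the run down to fewer than `|S|` copies, then fill up to exactly `|S|` with the free loop at
`g`. -/
theorem NonnegCycles.le_of_zero_cycle_right (h : NonnegCycles wt B w) (n : ℕ) {s g : S}
    (hs : s ∈ B) (hg : mwt wt w g g ≤ 0) :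
    mwt wt (wpow w (Fintype.card S)) s g ≤ mwt wt (wpow w n) s g := by
  by_cases hr : mwt wt (wpow w n) s g = ⊤
  · simp [hr]
  obtain ⟨n', h1, h2⟩ := h.exists_short n hs hr
  obtain ⟨c, hc⟩ := Nat.exists_eq_add_of_le h1.le
  rw [hc, wpow_add]
  exact (mwt_append_le wt _ _ _ g _).trans
    ((add_le_of_nonpos_right (mwt_wpow_self_le_zero wt hg c)).trans h2)

theorem NonnegCycles.le_of_zero_cycle_left (h : NonnegCycles wt B w) (n : ℕ) {g r : S}
    (hgB : g ∈ B) (hg : mwt wt w g g ≤ 0) :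
    mwt wt (wpow w (Fintype.card S)) g r ≤ mwt wt (wpow w n) g r := by
  by_cases hr : mwt wt (wpow w n) g r = ⊤
  · simp [hr]
  obtain ⟨n', h1, h2⟩ := h.exists_short n hgB hr
  obtain ⟨c, hc⟩ := Nat.exists_eq_add_of_le' h1.le
  rw [hc, wpow_add]
  exact (mwt_append_le wt _ _ _ g _).trans
    ((add_le_of_nonpos_left (mwt_wpow_self_le_zero wt hg c)).trans h2)

/-- If zero cycles on powers of `w` yield zero cycles on `w` itself, then an optimal run on `w ^ n`
can be replaced by a short run through a zero cycle, or its weight grows with `n`. -/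
theorem NonnegCycles.zero_cycle_or_le (h : NonnegCycles wt B w)
    (hz : ∀ n, 1 ≤ n → ∀ g ∈ B, mwt wt (wpow w n) g g ≤ 0 → mwt wt w g g ≤ 0)
    (n : ℕ) {s r : S} (hs : s ∈ B) {e : ℤ} (he : mwt wt (wpow w n) s r = e) :
    (∃ g ∈ B, mwt wt w g g ≤ 0 ∧ mwt wt (wpow w (Fintype.card S)) s g +
      mwt wt (wpow w (Fintype.card S)) g r ≤ e) ∨
    (n : ℤ) ≤ Fintype.card S * (e + Fintype.card S * maxeff wt w) + Fintype.card S := by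
  induction n using Nat.strong_induction_on generalizing e with
  | _ n ih =>
    by_cases hn : n < Fintype.card S
    · right
      -- A short run weighs at least `-|S| * maxeff w`, so the product in the bound is nonnegative
      -- and the summand `|S|` alone covers `n`.
      have h1 := natAbs_le_maxeff wt he
      rw [maxeff_wpow] at h1
      have h2 : n * maxeff wt w ≤ Fintype.card S * maxeff wt w := by gcongr
      have h3 : (0 : ℤ) ≤ e + Fintype.card S * maxeff wt w := by
        have : (((Fintype.card S * maxeff wt w : ℕ)) : ℤ) = Fintype.card S * maxeff wt w := by
          push_cast; ring
        omega
      have h4 : (0 : ℤ) ≤ Fintype.card S * (e + Fintype.card S * maxeff wt w) :=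
        mul_nonneg (by positivity) h3
      omega
    obtain ⟨a, l, b, p, h1, h2, h3, h4⟩ := exists_cycle wt (not_lt.1 hn) (by rw [he]; simp)
    rw [he] at h4
    have h5 := ne_top_of_le_ne_top WithTop.coe_ne_top h4
    rw [WithTop.add_ne_top, WithTop.add_ne_top] at h5
    have hp := mem_of_mwt_wpow_ne_top wt h.closed hs h5.1.1
    have h6 := h.nonneg l p hp
    by_cases hpz : mwt wt w p p ≤ 0
    · left
      refine ⟨p, hp, hpz, le_trans ?_ h4⟩
      gcongr
      · exact (h.le_of_zero_cycle_right a hs hpz).trans (le_add_of_nonneg_right h6)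
      · exact h.le_of_zero_cycle_left b hp hpz
    -- Cutting out a cycle of positive weight removes at most `|S|` copies and saves at least 1, so
    -- the bound drops by at least `|S|` and the induction closes.
    have h7 : ¬ mwt wt (wpow w l) p p ≤ 0 := fun h8 => hpz (hz l h2 p hp h8)
    have h8 : mwt wt (wpow w (a + b)) s r ≤
        mwt wt (wpow w a) s p + mwt wt (wpow w b) p r := by
      rw [wpow_add]; exact mwt_append_le wt _ _ _ p _
    obtain ⟨e₁, h9⟩ := WithTop.ne_top_iff_exists.1 h5.1.1
    obtain ⟨e₂, h10⟩ := WithTop.ne_top_iff_exists.1 h5.1.2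
    obtain ⟨e₃, h11⟩ := WithTop.ne_top_iff_exists.1 h5.2
    rw [← h9, ← h11] at h8
    obtain ⟨e', h12⟩ := WithTop.ne_top_iff_exists.1
      (ne_top_of_le_ne_top (by simp) h8)
    rw [← h9, ← h10, ← h11] at h4
    rw [← h10] at h7
    rw [← h12] at h8
    norm_cast at h4 h7 h8
    rcases ih (a + b) (by omega) h12.symm with ⟨g, hg, hgz, h13⟩ | h13
    · left
      refine ⟨g, hg, hgz, h13.trans ?_⟩
      norm_cast
      omega
    · right
      have h14 : (Fintype.card S : ℤ) * (e' + 1 + Fintype.card S * maxeff wt w) ≤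
          Fintype.card S * (e + Fintype.card S * maxeff wt w) := by
        gcongr
        omega
      have h15 : (Fintype.card S : ℤ) * (e' + 1 + Fintype.card S * maxeff wt w) =
          Fintype.card S * (e' + Fintype.card S * maxeff wt w) + Fintype.card S := by ring
      push_cast at h13
      omega

/-- The zero cycle at `s` makes the minimal reflexive weight 0. Being minimal is then lying on a
zero cycle, whose length can be normalised to `|S|!`, a divisor of `bigM S`. -/
theorem NonnegCycles.mem_minStates_iff (h : NonnegCycles wt B w)
    (h0 : ∃ s ∈ B, mwt wt (wpow w (bigM S)) s s = 0) {g : S} :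
    g ∈ minStates wt B (wpow w (bigM S)) ↔
      g ∈ B ∧ mwt wt (wpow w (Fintype.card S).factorial) g g ≤ 0 := by
  obtain ⟨s, hs, h0⟩ := h0
  have hpos : 1 ≤ Fintype.card S := Fintype.card_pos_iff.2 ⟨s⟩
  have hM : 1 ≤ bigM S := Nat.mul_pos hpos (Nat.factorial_pos _)
  constructor
  · rintro ⟨⟨hg, -⟩, hmin⟩
    refine ⟨hg, h.factorial_cycle (bigM S) hM hg ?_⟩
    rw [← h0]
    exact hmin s ⟨hs, by simp [h0]⟩
  · rintro ⟨hg, hz⟩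
    have h1 : mwt wt (wpow w (bigM S)) g g ≤ 0 := by
      rw [bigM, Nat.mul_comm, ← wpow_wpow]
      exact mwt_wpow_self_le_zero wt hz _
    exact ⟨⟨hg, ne_top_of_le_ne_top WithTop.zero_ne_top h1⟩,
      fun r hr => h1.trans (h.nonneg _ r hr.1)⟩

-- Stabilisation weights and unfolding constants

open Classical in
theorem stabWeight_ne_top_iff {s r : S} : stabWeight wt B w s r ≠ ⊤ ↔ Grounded wt B w s r := by
  unfold stabWeight
  split_ifs with h
  · refine ⟨fun _ => h, fun _ => ?_⟩
    obtain ⟨-, -, g, hg, h1, h2⟩ := h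
    exact ne_top_of_le_ne_top (WithTop.add_ne_top.2 ⟨h1, h2⟩)
      (Finset.inf_le (Finset.mem_filter.2 ⟨Finset.mem_univ g, hg⟩))
  · simp [h]

open Classical in
theorem stabWeight_le {s r g : S} (hs : s ∈ B) (hr : r ∈ B)
    (hg : g ∈ minStates wt B (wpow w (bigM S))) :
    stabWeight wt B w s r ≤
      mwt wt (wpow w (bigM S)) s g + mwt wt (wpow w (bigM S)) g r := by
  by_cases h : mwt wt (wpow w (bigM S)) s g + mwt wt (wpow w (bigM S)) g r = ⊤
  · simp [h]
  have h1 : Grounded wt B w s r := ⟨hs, hr, g, hg, WithTop.add_ne_top.1 h⟩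
  rw [stabWeight, if_pos h1]
  exact Finset.inf_le (Finset.mem_filter.2 ⟨Finset.mem_univ g, hg⟩)

theorem exists_stabWeight_eq {s r : S} (h : Grounded wt B w s r) :
    ∃ g ∈ minStates wt B (wpow w (bigM S)), stabWeight wt B w s r =
      mwt wt (wpow w (bigM S)) s g + mwt wt (wpow w (bigM S)) g r := by
  obtain ⟨-, -, g, hg, -⟩ := id h
  classical
  rw [stabWeight, if_pos h]
  obtain ⟨g', h1, h2⟩ := Finset.exists_mem_eq_inf
    (Finset.univ.filter fun g => g ∈ minStates wt B (wpow w (bigM S)))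
    ⟨g, Finset.mem_filter.2 ⟨Finset.mem_univ g, hg⟩⟩ (fun g =>
      mwt wt (wpow w (bigM S)) s g + mwt wt (wpow w (bigM S)) g r)
  refine ⟨g', (Finset.mem_filter.1 h1).2, ?_⟩
  convert h2

theorem NonnegCycles.exists_isUnfoldingConstant (h : NonnegCycles wt B w)
    (h0 : ∃ s ∈ B, mwt wt (wpow w (bigM S)) s s = 0) (F : ℕ) :
    ∃ M₀, IsUnfoldingConstant wt B w F M₀ := by
  set y := wpow w (Fintype.card S).factorial with hy
  -- `C` dominates both `F` and all finite stabilisation weights, the latter being treated as the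
  -- weights of a single letter.
  set C : ℕ := F + wmax (fun _ : Unit => stabWeight wt B w) () with hC
  have hpos : 1 ≤ Fintype.card S := by
    obtain ⟨s, -⟩ := h0
    exact Fintype.card_pos_iff.2 ⟨s⟩
  have hM : wpow w (bigM S) = wpow y (Fintype.card S) := by
    rw [hy, wpow_wpow, bigM, Nat.mul_comm]
  have hM2 (k : ℕ) :
      wpow w (2 * bigM S * k) = wpow y (2 * Fintype.card S * k) := by
    rw [hy, wpow_wpow, bigM]
    congr 1
    ring
  have hyn : NonnegCycles wt B y := h.pow _
  have hz : ∀ n, 1 ≤ n → ∀ g ∈ B, mwt wt (wpow y n) g g ≤ 0 → mwt wt y g g ≤ 0 := by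
    intro n hn g hg hg0
    rw [hy, wpow_wpow] at hg0
    exact h.factorial_cycle _ (Nat.mul_pos (Nat.factorial_pos _) hn) hg hg0
  -- `w ^ (2 m k)` is `2 |S| k` copies of `y`. A weight at most `C` off the zero cycles would force
  -- `2 |S| k ≤ |S| (C + |S| * maxeff y + 1)`, which fails for `k` at least this constant.
  refine ⟨C + Fintype.card S * maxeff wt y + 1, fun k hk s hs r hr => ?_⟩
  have hlarge : ∀ e : ℤ, mwt wt (wpow w (2 * bigM S * k)) s r = e →
      (stabWeight wt B w s r ≤ e ∧ Grounded wt B w s r) ∨ (C : ℤ) < e := by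
    intro e he
    rw [hM2] at he
    rcases hyn.zero_cycle_or_le hz _ hs he with ⟨g, hg, hg0, hle⟩ | hle
    · left
      rw [← hM] at hle
      have hgm := (h.mem_minStates_iff h0).2 ⟨hg, hg0⟩
      refine ⟨(stabWeight_le hs hr hgm).trans hle, hs, hr, g, hgm, ?_⟩
      exact WithTop.add_ne_top.1 (ne_top_of_le_ne_top WithTop.coe_ne_top hle)
    · right
      by_contra hlt
      have h1 : (Fintype.card S : ℤ) * (e + Fintype.card S * maxeff wt y) ≤
          Fintype.card S * (C + Fintype.card S * maxeff wt y) := by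
        gcongr
        omega
      have h2 : 2 * Fintype.card S * (C + Fintype.card S * maxeff wt y + 1) ≤
          2 * Fintype.card S * k := by gcongr
      have h3 : (2 * Fintype.card S * (C + Fintype.card S * maxeff wt y + 1) : ℤ) ≤
          2 * Fintype.card S * k := by exact_mod_cast h2
      have h4 : (0 : ℤ) ≤ Fintype.card S * (C + Fintype.card S * maxeff wt y) := by positivity
      push_cast at hle
      nlinarith
  refine ⟨fun hng => ?_, fun hgr => le_antisymm ?_ ?_⟩
  · by_cases htop : mwt wt (wpow w (2 * bigM S * k)) s r = ⊤
    · rw [htop]; exact WithTop.coe_lt_top _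
    obtain ⟨e, he⟩ := WithTop.ne_top_iff_exists.1 htop
    rw [← he]
    rcases hlarge e he.symm with h1 | h1
    · exact absurd h1.2 hng
    · norm_cast
      omega
  · obtain ⟨g, hg, hgw⟩ := exists_stabWeight_eq hgr
    obtain ⟨c, rfl⟩ := Nat.exists_eq_add_of_le' (show 1 ≤ k by omega)
    have h1 := ((h.mem_minStates_iff h0).1 hg).2
    have h2 : mwt wt (wpow w (2 * bigM S * c)) g g ≤ 0 := by
      rw [hM2]
      exact mwt_wpow_self_le_zero wt h1 _
    -- Only the first and last `m` copies do work; the `2 m c` copies between them loop at `g` for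
    -- free.
    rw [hgw, show 2 * bigM S * (c + 1) = bigM S + (2 * bigM S * c + bigM S) by ring, wpow_add,
      wpow_add]
    refine (mwt_append_le wt _ _ _ g _).trans ?_
    gcongr
    exact (mwt_append_le wt _ _ _ g _).trans (add_le_of_nonpos_left h2)
  · by_cases htop : mwt wt (wpow w (2 * bigM S * k)) s r = ⊤
    · simp [htop]
    obtain ⟨e, he⟩ := WithTop.ne_top_iff_exists.1 htop
    rw [← he]
    rcases hlarge e he.symm with h1 | h1
    · exact h1.1
    · obtain ⟨c, hc⟩ := WithTop.ne_top_iff_exists.1 (stabWeight_ne_top_iff.2 hgr)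
      have h2 := natAbs_le_wmax (fun _ : Unit => stabWeight wt B w) (a := ()) hc.symm
      rw [← hc]
      norm_cast
      omega

/-- The detour from `s` through `t` to the grounding state `g` uses `2 m k + m` copies. As `g` has a
zero cycle, it compresses to the `m` copies that groundedness allows. -/
theorem NonnegCycles.grounded_of_reach (h : NonnegCycles wt B w)
    (h0 : ∃ s ∈ B, mwt wt (wpow w (bigM S)) s s = 0) {k : ℕ} {s t r : S} (hs : s ∈ B)
    (hst : mwt wt (wpow w (2 * bigM S * k)) s t ≠ ⊤) (hg : Grounded wt B w t r) :
    Grounded wt B w s r := by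
  obtain ⟨-, hr, g, hg, h1, h2⟩ := hg
  refine ⟨hs, hr, g, hg, ?_, h2⟩
  have h3 := (h.pow (Fintype.card S).factorial).le_of_zero_cycle_right
    (2 * Fintype.card S * k + Fintype.card S) hs ((h.mem_minStates_iff h0).1 hg).2
  rw [wpow_wpow, wpow_wpow, Nat.mul_comm,
    show (Fintype.card S).factorial * (2 * Fintype.card S * k + Fintype.card S) =
      2 * bigM S * k + bigM S by rw [bigM]; ring, wpow_add] at h3
  exact ne_top_of_le_ne_top (mwt_append_ne_top wt hst h1) h3

/-- Reachability on `w ^ (2 * m * k)` does not depend on `k ≥ 1`. -/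
theorem mwt_wpow_ne_top_of_ne_top {k k' : ℕ} {s r : S} (hk : 1 ≤ k) (hk' : 1 ≤ k')
    (h : mwt wt (wpow w (2 * bigM S * k)) s r ≠ ⊤) :
    mwt wt (wpow w (2 * bigM S * k')) s r ≠ ⊤ := by
  set N := (Fintype.card S).factorial with hN
  have hpos : 1 ≤ Fintype.card S := Fintype.card_pos_iff.2 ⟨s⟩
  have hNpos : 1 ≤ N := Nat.factorial_pos _
  have hM (k : ℕ) : 2 * bigM S * k = N * (2 * Fintype.card S * k) := by
    rw [bigM, hN]; ring
  -- A run on at least `|S|` copies has a cycle whose length divides `N`, so going around it more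
  -- often adds exactly `N` copies.
  have hpump : ∀ n, 1 ≤ n → mwt wt (wpow w (N * n)) s r ≠ ⊤ →
      mwt wt (wpow w (N * (n + 1))) s r ≠ ⊤ := by
    intro n hn h1
    have h2 : Fintype.card S ≤ N * n :=
      (Nat.self_le_factorial _).trans (Nat.le_mul_of_pos_right _ hn)
    obtain ⟨a, l, b, p, h3, h4, h5, h6⟩ := exists_cycle wt h2 h1
    have h7 := ne_top_of_le_ne_top h1 h6
    rw [WithTop.add_ne_top, WithTop.add_ne_top] at h7
    obtain ⟨c, hc⟩ := Nat.dvd_factorial (by omega) h5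
    have h8 : N * (n + 1) = a + (l * (c + 1) + b) := by
      rw [Nat.mul_succ, Nat.mul_succ, ← h3, ← hc]; ring
    rw [h8, wpow_add, wpow_add, ← wpow_wpow]
    exact mwt_append_ne_top wt h7.1.1
      (mwt_append_ne_top wt (mwt_wpow_self_ne_top wt h7.1.2 _) h7.2)
  -- Cycles are cut at the level of blocks `w ^ N`, so the length stays a multiple of `N`. The
  -- descent reaches at most `|S|` blocks, from where pumping attains `2 |S| k'`.
  have hred : ∀ n, 1 ≤ n → mwt wt (wpow w (N * n)) s r ≠ ⊤ →
      ∃ n', 1 ≤ n' ∧ n' ≤ Fintype.card S ∧ mwt wt (wpow w (N * n')) s r ≠ ⊤ := by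
    intro n
    induction n using Nat.strong_induction_on with
    | _ n ih =>
      intro hn h1
      by_cases hn' : n ≤ Fintype.card S
      · exact ⟨n, hn, hn', h1⟩
      rw [← wpow_wpow] at h1
      obtain ⟨a, l, b, p, h3, h4, h5, h6⟩ := exists_cycle wt (by omega) h1
      have h7 := ne_top_of_le_ne_top h1 h6
      rw [WithTop.add_ne_top, WithTop.add_ne_top] at h7
      refine ih (a + b) (by omega) (by omega) ?_
      rw [← wpow_wpow, wpow_add]
      exact mwt_append_ne_top wt h7.1.1 h7.2
  rw [hM] at h ⊢
  have h2k : 1 * 1 ≤ 2 * Fintype.card S * k := Nat.mul_le_mul (by omega) hk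
  obtain ⟨n, h1, h2, h3⟩ := hred _ h2k h
  have h4 : n ≤ 2 * Fintype.card S * k' := by
    refine h2.trans ?_
    calc Fintype.card S ≤ 2 * Fintype.card S := by omega
      _ ≤ 2 * Fintype.card S * k' := Nat.le_mul_of_pos_right _ hk'
  generalize 2 * Fintype.card S * k' = j at h4
  induction j, h4 using Nat.le_induction with
  | base => exact h3
  | succ j hj ih => exact hpump j (by omega) ih

/-- Replacing a stabilisation by sufficiently many repetitions does not increase weights. -/
theorem IsUnfoldingConstant.mwt_le {a : Γ} (ha : wt a = stabWeight wt B w) {F M₀ : ℕ}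
    (hM : IsUnfoldingConstant wt B w F M₀) (u v : List Γ) (s q : S) :
    mwt wt (u ++ wpow w (2 * bigM S * M₀) ++ v) s q ≤ mwt wt (u ++ a :: v) s q := by
  obtain ⟨t, ht⟩ := exists_mwt_append_eq wt u (a :: v) s q
  obtain ⟨r, hr⟩ := exists_mwt_cons_eq wt a v t q
  have h1 : mwt wt (wpow w (2 * bigM S * M₀)) t r ≤ wt a t r := by
    rw [ha]
    by_cases h : Grounded wt B w t r
    · exact ((hM M₀ le_rfl t h.1 r h.2.1).2 h).le
    · rw [not_not.1 (mt stabWeight_ne_top_iff.1 h)]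
      exact le_top
  rw [ht, hr, List.append_assoc]
  refine (mwt_append_le wt _ _ _ t _).trans ?_
  gcongr
  refine (mwt_append_le wt _ _ _ r _).trans ?_
  gcongr

/-- Replacing a stabilisation by sufficiently many repetitions changes only infinite weights, and
only to very large ones. -/
theorem IsUnfoldingConstant.mwt_eq_or {a : Γ} (ha : wt a = stabWeight wt B w) {F M₀ : ℕ}
    (hM : IsUnfoldingConstant wt B w F M₀) (hB : reach wt B w ⊆ B) {u v : List Γ} {s : S}
    (hu : reach wt {s} u ⊆ B) (hF : 2 * maxeff wt (u ++ a :: v) ≤ F) (q : S) :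
    mwt wt (u ++ wpow w (2 * bigM S * M₀) ++ v) s q = mwt wt (u ++ a :: v) s q ∨
      (mwt wt (u ++ a :: v) s q = ⊤ ∧ (((maxeff wt (u ++ a :: v) : ℤ) : Weight) <
        mwt wt (u ++ wpow w (2 * bigM S * M₀) ++ v) s q)) := by
  have hle := hM.mwt_le ha u v s q
  obtain ⟨r, hr⟩ := exists_mwt_append_eq wt (u ++ wpow w (2 * bigM S * M₀)) v s q
  obtain ⟨t, ht⟩ := exists_mwt_append_eq wt u (wpow w (2 * bigM S * M₀)) s r
  by_cases htop : mwt wt (u ++ wpow w (2 * bigM S * M₀) ++ v) s q = ⊤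
  · left
    rw [htop] at hle ⊢
    exact (top_le_iff.1 hle).symm
  have hfin := htop
  rw [hr, ht, ← ne_eq, WithTop.add_ne_top, WithTop.add_ne_top] at hfin
  have htB : t ∈ B := hu ⟨s, rfl, hfin.1.1⟩
  have hrB : r ∈ B := mem_of_mwt_wpow_ne_top wt hB htB hfin.1.2
  have hconst := hM M₀ le_rfl t htB r hrB
  by_cases hg : Grounded wt B w t r
  · left
    refine le_antisymm hle ?_
    rw [hr, ht, hconst.2 hg, ← ha, add_assoc]
    refine (mwt_append_le wt _ _ _ t _).trans ?_
    gcongr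
    exact mwt_cons_le wt _ _ _ _ _
  · right
    -- The middle part exceeds `F`, and `u` and `v` can reduce this by at most their maximal
    -- effects, so the total exceeds `maxeff (u ++ a :: v)`. A finite weight through the letter `a`
    -- would be at most that, contradicting `hle`.
    have h1 := hconst.1 hg
    obtain ⟨e₁, he₁⟩ := WithTop.ne_top_iff_exists.1 hfin.1.1
    obtain ⟨e₂, he₂⟩ := WithTop.ne_top_iff_exists.1 hfin.1.2
    obtain ⟨e₃, he₃⟩ := WithTop.ne_top_iff_exists.1 hfin.2
    have h2 := natAbs_le_maxeff wt he₁.symm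
    have h3 := natAbs_le_maxeff wt he₃.symm
    have h4 : ((maxeff wt (u ++ a :: v) : ℤ) : Weight) <
        mwt wt (u ++ wpow w (2 * bigM S * M₀) ++ v) s q := by
      rw [← he₂] at h1
      rw [hr, ht, ← he₁, ← he₂, ← he₃]
      rw [maxeff_append, maxeff_cons] at hF ⊢
      norm_cast at h1 ⊢
      omega
    refine ⟨?_, h4⟩
    by_contra h5
    obtain ⟨c, hc⟩ := WithTop.ne_top_iff_exists.1 h5
    have h6 := natAbs_le_maxeff wt hc.symm
    have h7 := h4.trans_le hle
    rw [← hc] at h7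
    norm_cast at h7
    omega

end General

end CactusWFA

-- Frames, baseline runs and seamlessness

namespace CactusWFA

theorem prefix_append_cases {α : Type*} {l l₁ l₂ : List α} (h : l <+: l₁ ++ l₂) :
    l <+: l₁ ∨ ∃ l', l' <+: l₂ ∧ l = l₁ ++ l' := by
  rcases List.prefix_or_prefix_of_prefix h (List.prefix_append l₁ l₂) with h1 | ⟨l', rfl⟩
  · exact Or.inl h1
  · exact Or.inr ⟨l', (List.prefix_append_right_inj l₁).1 h, rfl⟩

section Runs

variable {Γ S : Type*} [Fintype S] [DecidableEq S] {wt : Γ → S → S → Weight}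

theorem mem_reach_singleton {s r : S} {w : List Γ} :
    r ∈ reach wt {s} w ↔ mwt wt w s r ≠ ⊤ := by
  simp [reach]

theorem runWeight_take_ne_top {ρ : List (Γ × S)} {s : S} (h : runWeight wt s ρ ≠ ⊤) (j : ℕ) :
    runWeight wt s (ρ.take j) ≠ ⊤ := by
  induction ρ generalizing s j with
  | nil => simpa using h
  | cons x ρ ih =>
    obtain ⟨a, t⟩ := x
    cases j with
    | zero => simp [runWeight]
    | succ j =>
      simp only [runWeight, List.take_succ_cons, WithTop.add_ne_top] at h ⊢
      exact ⟨h.1, ih h.2 j⟩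

end Runs

namespace AugState

variable {Q : Type*}

theorem SameFrame.refl (s : AugState Q) : s.SameFrame s := ⟨rfl, rfl⟩

theorem SameFrame.symm {s t : AugState Q} (h : s.SameFrame t) : t.SameFrame s :=
  ⟨h.1.symm, h.2.symm⟩

theorem SameFrame.trans {s t r : AugState Q} (h : s.SameFrame t) (h' : t.SameFrame r) :
    s.SameFrame r :=
  ⟨h.1.trans h'.1, h.2.trans h'.2⟩

/-- The baseline state with the same last two components. -/
def baseline (s : AugState Q) : AugState Q := ⟨(s.base, s.base, s.rset), s.2.2, s.2.2⟩

theorem isBaseline_baseline (s : AugState Q) : s.baseline.IsBaseline := rfl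

theorem sameFrame_baseline (s : AugState Q) : s.baseline.SameFrame s := ⟨rfl, rfl⟩

theorem IsBaseline.eq_of_sameFrame {s t : AugState Q} (hs : s.IsBaseline) (ht : t.IsBaseline)
    (h : s.SameFrame t) : s = t := by
  refine Subtype.ext (Prod.ext ?_ (Prod.ext h.1 h.2))
  exact (hs.trans h.1).trans ht.symm

theorem IsBaseline.baseline_eq {s t : AugState Q} (hs : s.IsBaseline) (h : t.SameFrame s) :
    t.baseline = s :=
  (isBaseline_baseline t).eq_of_sameFrame hs ((sameFrame_baseline t).trans h)

end AugState

section Cactus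

variable {Q Sig : Type*} [Fintype Q] [DecidableEq Q] {A : WFA Q Sig} {L : ℕ → ℕ}
  {B : Set (AugState Q)} {w : List (Letter Q Sig)}

theorem WFA.isBaseline_augInit : A.augInit.IsBaseline := rfl

theorem IsReflexiveCycle.sameFrame {s t r : AugState Q} (h : IsReflexiveCycle A B w s)
    (ht : t ∈ B) (hr : r ∈ B) : t.SameFrame r := by
  rw [h.2.1] at ht hr
  exact AugState.SameFrame.trans ht (AugState.SameFrame.symm hr)

theorem IsReflexiveCycle.mem {s : AugState Q} (h : IsReflexiveCycle A B w s) : s ∈ B := by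
  rw [h.2.1]
  exact AugState.SameFrame.refl s

theorem IsReflexiveCycle.mem_of_sameFrame {s t r : AugState Q} (h : IsReflexiveCycle A B w s)
    (ht : t ∈ B) (htr : r.SameFrame t) : r ∈ B := by
  rw [h.2.1] at ht ⊢
  exact htr.trans ht

theorem IsReflexiveCycle.baseline_eq {s t : AugState Q} (h : IsReflexiveCycle A B w s)
    (ht : t ∈ B) : t.baseline = s :=
  h.1.baseline_eq (h.sameFrame ht h.mem)

theorem IsStableCycle.nonnegCycles (h : IsStableCycle A B w) : NonnegCycles (lw A) B w := by
  obtain ⟨s, hs, h⟩ := h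
  refine ⟨hs.2.2, fun n p hp => ?_⟩
  by_cases hp' : mwt (lw A) (wpow w n) p p = ⊤
  · simp [hp']
  · rw [← (h n).2]
    exact (h n).1.2 p ⟨hp, hp'⟩

theorem IsStableCycle.exists_zero_cycle (h : IsStableCycle A B w) (n : ℕ) :
    ∃ s ∈ B, mwt (lw A) (wpow w n) s s = 0 := by
  obtain ⟨s, hs, h⟩ := h
  exact ⟨s, hs.mem, (h n).2⟩

/-- The route through `s` itself costs 0; any other grounded route is a cycle at `s` on `w ^ (2 m)`,
and those cost at least 0 by stability. -/
theorem stabWeight_baseline {s : AugState Q} (hs : IsReflexiveCycle A B w s)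
    (h : ∀ n : ℕ, s ∈ minStates (lw A) B (wpow w n) ∧ mwt (lw A) (wpow w n) s s = 0) :
    stabWeight (lw A) B w s s = 0 := by
  have h1 := h (bigM (AugState Q))
  have h2 := stabWeight_le hs.mem hs.mem h1.1
  rw [h1.2, add_zero] at h2
  refine le_antisymm h2 ?_
  obtain ⟨g, -, hg⟩ := exists_stabWeight_eq
    (stabWeight_ne_top_iff.1 (ne_top_of_le_ne_top WithTop.zero_ne_top h2))
  rw [hg, ← (h (bigM (AugState Q) + bigM (AugState Q))).2, wpow_add]
  exact mwt_append_le _ _ _ _ _ _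

theorem LengthBounded.isStableCycle (h : LengthBounded A L (.cactus B w)) :
    IsStableCycle A B w := by
  cases h
  assumption

theorem LengthBounded.letters (h : LengthBounded A L (.cactus B w)) :
    ∀ a ∈ w, LengthBounded A L a := by
  cases h
  assumption

/-- Without rebase and jump letters the last two components evolve deterministically: a standard
letter prescribes them, a cactus letter stays in the single frame `B`. -/
theorem LengthBounded.sameFrame {a : Letter Q Sig} (ha : LengthBounded A L a)
    {s s' t t' : AugState Q} (h : lw A a s t ≠ ⊤) (h' : lw A a s' t' ≠ ⊤) (hs : s.SameFrame s') :
    t.SameFrame t' := by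
  cases ha with
  | base p σ q =>
    simp only [lw, baseWeight, ne_eq, ite_eq_right_iff, Classical.not_imp] at h h'
    exact ⟨h.1.2.2.1.trans h'.1.2.2.1.symm, by rw [h.1.2.2.2, h'.1.2.2.2, hs.2]⟩
  | cactus B w h1 h2 =>
    obtain ⟨s₀, hs₀, -⟩ := h2
    rw [lw_cactus, stabWeight_ne_top_iff] at h h'
    exact hs₀.sameFrame h.2.1 h'.2.1

/-- On a standard letter the baseline transition is normalised to `c - c`; on a cactus letter both
baseline states are the distinguished state of the stable cycle. -/
theorem LengthBounded.lw_baseline {a : Letter Q Sig} (ha : LengthBounded A L a)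
    {s t : AugState Q} (h : lw A a s t ≠ ⊤) : lw A a s.baseline t.baseline = 0 := by
  cases ha with
  | base p σ q =>
    simp only [lw, baseWeight, ne_eq, ite_eq_right_iff, Classical.not_imp] at h
    obtain ⟨⟨h1, h2, h3, h4⟩, -⟩ := h
    obtain ⟨c, hc⟩ := WithTop.ne_top_iff_exists.1 h1
    have h5 : (if A.wt p σ q ≠ ⊤ ∧ s.baseline.base = p ∧ t.baseline.base = q ∧
        t.baseline.rset = A.step s.baseline.rset σ then
        wsub (A.wt s.baseline.inner σ t.baseline.inner) (A.wt p σ q) else ⊤) = 0 := by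
      rw [if_pos ⟨h1, h2, h3, h4⟩]
      have h6 : s.baseline.inner = p := h2
      have h7 : t.baseline.inner = q := h3
      rw [h6, h7, ← hc]
      change ((c - c : ℤ) : Weight) = 0
      simp
    simpa only [lw, baseWeight] using h5
  | cactus B w h1 h2 =>
    obtain ⟨s₀, hs₀, h3⟩ := h2
    rw [lw_cactus, stabWeight_ne_top_iff] at h
    rw [lw_cactus, hs₀.baseline_eq h.1, hs₀.baseline_eq h.2.1]
    exact stabWeight_baseline hs₀ h3

theorem sameFrame_of_mwt (hw : ∀ a ∈ w, LengthBounded A L a) {s s' t t' : AugState Q}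
    (h : mwt (lw A) w s t ≠ ⊤) (h' : mwt (lw A) w s' t' ≠ ⊤) (hs : s.SameFrame s') :
    t.SameFrame t' := by
  induction w generalizing s s' with
  | nil => rwa [← eq_of_mwt_nil _ h, ← eq_of_mwt_nil _ h']
  | cons a w ih =>
    obtain ⟨p, h1, h2⟩ := exists_of_mwt_cons_ne_top _ h
    obtain ⟨p', h1', h2'⟩ := exists_of_mwt_cons_ne_top _ h'
    exact ih (fun b hb => hw b (List.mem_cons_of_mem _ hb)) h2 h2'
      ((hw a List.mem_cons_self).sameFrame h1 h1' hs)

theorem exists_baseline_run (hw : ∀ a ∈ w, LengthBounded A L a) {s t : AugState Q}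
    (h : mwt (lw A) w s t ≠ ⊤) :
    ∃ ρ : List (Letter Q Sig × AugState Q), ρ.map Prod.fst = w ∧ (∀ x ∈ ρ, x.2.IsBaseline) ∧
      runEnd s.baseline ρ = t.baseline ∧ runWeight (lw A) s.baseline ρ = 0 := by
  induction w generalizing s with
  | nil => exact ⟨[], rfl, by simp, by rw [eq_of_mwt_nil _ h, runEnd], rfl⟩
  | cons a w ih =>
    obtain ⟨p, h1, h2⟩ := exists_of_mwt_cons_ne_top _ h
    obtain ⟨ρ, h3, h4, h5, h6⟩ := ih (fun b hb => hw b (List.mem_cons_of_mem _ hb)) h2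
    refine ⟨(a, p.baseline) :: ρ, by simp [h3], ?_, h5, ?_⟩
    · intro x hx
      rcases List.mem_cons.1 hx with rfl | hx
      · exact p.isBaseline_baseline
      · exact h4 x hx
    · rw [runWeight, h6, (hw a List.mem_cons_self).lw_baseline h1, add_zero]

theorem mwt_baseline_le_zero (hw : ∀ a ∈ w, LengthBounded A L a) {s t : AugState Q}
    (h : mwt (lw A) w s t ≠ ⊤) : mwt (lw A) w s.baseline t.baseline ≤ 0 := by
  obtain ⟨ρ, rfl, -, h1, h2⟩ := exists_baseline_run hw h
  rw [← h1, ← h2]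
  exact mwt_le_runWeight _ _ _

theorem runWeight_eq_zero_of_isBaseline {ρ : List (Letter Q Sig × AugState Q)}
    (hw : ∀ x ∈ ρ, LengthBounded A L x.1) (hρ : ∀ x ∈ ρ, x.2.IsBaseline) {s : AugState Q}
    (hs : s.IsBaseline) (h : runWeight (lw A) s ρ ≠ ⊤) : runWeight (lw A) s ρ = 0 := by
  induction ρ generalizing s with
  | nil => rfl
  | cons x ρ ih =>
    obtain ⟨a, t⟩ := x
    have ht : t.IsBaseline := hρ (a, t) List.mem_cons_self
    rw [runWeight, WithTop.add_ne_top] at h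
    have h1 := (hw (a, t) List.mem_cons_self).lw_baseline h.1
    rw [hs.baseline_eq (.refl s), ht.baseline_eq (.refl t)] at h1
    rw [runWeight, h1, zero_add]
    exact ih (fun y hy => hw y (List.mem_cons_of_mem _ hy))
      (fun y hy => hρ y (List.mem_cons_of_mem _ hy)) ht h.2

theorem isBaseline_runEnd {ρ : List (Letter Q Sig × AugState Q)}
    (hρ : ∀ x ∈ ρ, x.2.IsBaseline) {s : AugState Q} (hs : s.IsBaseline) :
    (runEnd s ρ).IsBaseline := by
  induction ρ generalizing s with
  | nil => exact hs
  | cons x ρ ih =>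
    exact ih (fun y hy => hρ y (List.mem_cons_of_mem _ hy)) (hρ x List.mem_cons_self)

/-- After each prefix at most one baseline state is reachable, since the frame is determined, and
the baseline run arrives there with weight 0. Minimality of that prefix therefore says that no run
to this state is negative. -/
theorem hasSeamlessBaselineRun_iff (hw : ∀ a ∈ w, LengthBounded A L a) :
    HasSeamlessBaselineRun A w ↔ (reach (lw A) {A.augInit} w).Nonempty ∧
      ∀ w', w' <+: w → ∀ t : AugState Q, t.IsBaseline → 0 ≤ mwt (lw A) w' A.augInit t := by
  have hinit : A.augInit.IsBaseline := A.isBaseline_augInit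
  constructor
  · rintro ⟨ρ, rfl, h1, h2, h3⟩
    refine ⟨⟨runEnd A.augInit ρ, mem_reach_singleton.2
      (ne_top_of_le_ne_top h1 (mwt_le_runWeight _ _ _))⟩, fun w' hw' t ht => ?_⟩
    have hj : w'.length ≤ ρ.length := by simpa using hw'.length_le
    have h4 := h3 _ hj
    rw [← List.prefix_iff_eq_take.1 hw'] at h4
    have hmem : ∀ x ∈ ρ.take w'.length, x ∈ ρ := fun x hx => List.mem_of_mem_take hx
    have h5 := runWeight_eq_zero_of_isBaseline
      (fun x hx => hw x.1 (List.mem_map_of_mem (hmem x hx))) (fun x hx => h2 x (hmem x hx))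
      hinit (runWeight_take_ne_top h1 w'.length)
    rw [h5] at h4
    by_cases htop : mwt (lw A) w' A.augInit t = ⊤
    · simp [htop]
    have h6 := sameFrame_of_mwt (fun a ha => hw a (hw'.subset ha)) htop
      (by rw [← h4]; exact WithTop.zero_ne_top) (.refl _)
    rw [ht.eq_of_sameFrame (isBaseline_runEnd (fun x hx => h2 x (hmem x hx)) hinit) h6]
    exact h4.le
  · rintro ⟨⟨r, hr⟩, h⟩
    obtain ⟨ρ, rfl, h1, -, h2⟩ := exists_baseline_run hw (mem_reach_singleton.1 hr)
    rw [hinit.baseline_eq (.refl _)] at h2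
    have h3 : runWeight (lw A) A.augInit ρ ≠ ⊤ := by rw [h2]; exact WithTop.zero_ne_top
    refine ⟨ρ, rfl, h3, h1, fun j hj => ?_⟩
    have hmem : ∀ x ∈ ρ.take j, x ∈ ρ := fun x hx => List.mem_of_mem_take hx
    have h4 := runWeight_eq_zero_of_isBaseline
      (fun x hx => hw x.1 (List.mem_map_of_mem (hmem x hx))) (fun x hx => h1 x (hmem x hx))
      hinit (runWeight_take_ne_top h3 j)
    refine le_antisymm ?_ ?_
    · rw [h4]
      exact h _ (List.take_prefix j _) _ (isBaseline_runEnd (fun x hx => h1 x (hmem x hx)) hinit)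
    · rw [← List.map_take]
      exact mwt_le_runWeight _ _ _

theorem jumpFree_of_lengthBounded (hw : ∀ a ∈ w, LengthBounded A L a) : JumpFree w := by
  intro s r h
  cases hw _ h

end Cactus

end CactusWFA

-- Unfolding a cactus letter: witnesses, dominance, seamlessness

namespace CactusWFA

section Unfolding

variable {Q Sig : Type*} [Fintype Q] [DecidableEq Q] {A : WFA Q Sig}

/-- Inner letters have smaller depth than the cactus letter, so the depth cap persists. -/
theorem mem_boundedCac_of_mem_word {L : ℕ → ℕ} {B : Set (AugState Q)} {x : List (Letter Q Sig)}
    (h : Letter.cactus B x ∈ boundedCac A L) : ∀ a ∈ x, a ∈ boundedCac A L := by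
  obtain ⟨k, hk, hL, rfl⟩ := h
  have hdep : ∀ w : List (Letter Q Sig), ∀ a ∈ w, dep a ≤ depWord w := by
    intro w
    induction w with
    | nil => simp
    | cons b w ih =>
      intro a ha
      rw [depWord]
      rcases List.mem_cons.1 ha with rfl | ha
      · exact le_max_left _ _
      · exact (ih a ha).trans (le_max_right _ _)
  intro a ha
  refine ⟨dep a, ?_, hL.letters a ha, rfl⟩
  rw [dep] at hk
  have := hdep x a ha
  omega

theorem IsSuffix.append_left {Ls Lg : ℕ → ℕ} {v z : List (Letter Q Sig)}
    (hv : ∀ a ∈ v, a ∈ boundedCac A Ls) (hz : IsSuffix A Ls Lg z) :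
    IsSuffix A Ls Lg (v ++ z) := by
  obtain ⟨y, a, hy, ha, rfl⟩ := hz
  refine ⟨v ++ y, a, ?_, ha, by simp⟩
  intro b hb
  rcases List.mem_append.1 hb with hb | hb
  · exact Or.inl (Or.inl (hv b hb))
  · exact hy b hb

/-- An unfolding of a readable cactus letter in a word over cactus letters. -/
structure IsUnfolding (A : WFA Q Sig) (L : ℕ → ℕ) (u v x : List (Letter Q Sig))
    (B : Set (AugState Q)) (F M₀ : ℕ) : Prop where
  mem : ∀ a ∈ u ++ Letter.cactus B x :: v, a ∈ boundedCac A L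
  bound : 2 * maxeff (lw A) (u ++ Letter.cactus B x :: v) ≤ F
  const : IsUnfoldingConstant (lw A) B x F M₀
  readable : (reach (lw A) {A.augInit} (u ++ [Letter.cactus B x])).Nonempty

namespace IsUnfolding

variable {L : ℕ → ℕ} {u v x : List (Letter Q Sig)} {B : Set (AugState Q)} {F M₀ : ℕ}

theorem of_prefix (h : IsUnfolding A L u v x B F M₀) {v' : List (Letter Q Sig)} (hv : v' <+: v) :
    IsUnfolding A L u v' x B F M₀ := by
  have h1 : u ++ Letter.cactus B x :: v' <+: u ++ Letter.cactus B x :: v :=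
    (List.prefix_append_right_inj u).2 ((List.prefix_cons_inj _).2 hv)
  exact ⟨fun a ha => h.mem a (h1.subset ha),
    (Nat.mul_le_mul_left 2 (maxeff_le_of_prefix _ h1)).trans h.bound, h.const, h.readable⟩

theorem mem_cactus (h : IsUnfolding A L u v x B F M₀) : Letter.cactus B x ∈ boundedCac A L :=
  h.mem _ (by simp)

theorem mem_left (h : IsUnfolding A L u v x B F M₀) : ∀ a ∈ u, a ∈ boundedCac A L :=
  fun a ha => h.mem a (by simp [ha])

theorem mem_right (h : IsUnfolding A L u v x B F M₀) : ∀ a ∈ v, a ∈ boundedCac A L :=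
  fun a ha => h.mem a (by simp [ha])

theorem mem_inner (h : IsUnfolding A L u v x B F M₀) : ∀ a ∈ x, a ∈ boundedCac A L :=
  mem_boundedCac_of_mem_word h.mem_cactus

theorem mem_unfolded (h : IsUnfolding A L u v x B F M₀) (n : ℕ) :
    ∀ a ∈ u ++ wpow x n ++ v, a ∈ boundedCac A L := by
  intro a ha
  simp only [List.mem_append] at ha
  rcases ha with (ha | ha) | ha
  · exact h.mem_left a ha
  · exact h.mem_inner a (mem_of_mem_wpow ha)
  · exact h.mem_right a ha

theorem lengthBounded_of_mem {w : List (Letter Q Sig)} (hw : ∀ a ∈ w, a ∈ boundedCac A L) :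
    ∀ a ∈ w, LengthBounded A L a := by
  intro a ha
  obtain ⟨k, -, h1, -⟩ := hw a ha
  exact h1

theorem stable (h : IsUnfolding A L u v x B F M₀) : IsStableCycle A B x := by
  obtain ⟨k, -, h1, -⟩ := h.mem_cactus
  exact h1.isStableCycle

theorem exists_mem_reach (h : IsUnfolding A L u v x B F M₀) :
    ∃ t ∈ B, mwt (lw A) u A.augInit t ≠ ⊤ := by
  obtain ⟨r, hr⟩ := h.readable
  obtain ⟨t, h1, h2⟩ := exists_of_mwt_append_ne_top _ (mem_reach_singleton.1 hr)
  rw [mwt_singleton, lw_cactus, stabWeight_ne_top_iff] at h2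
  exact ⟨t, h2.1, h1⟩

/-- Readability puts one state reached by `u` into `B`; all others share its frame, and `B` is a
full frame. -/
theorem reach_subset (h : IsUnfolding A L u v x B F M₀) : reach (lw A) {A.augInit} u ⊆ B := by
  obtain ⟨t, ht, ht'⟩ := h.exists_mem_reach
  obtain ⟨s, hs, -⟩ := h.stable
  intro r hr
  exact hs.mem_of_sameFrame ht (sameFrame_of_mwt (lengthBounded_of_mem h.mem_left)
    (mem_reach_singleton.1 hr) ht' (.refl _))

/-- If a suffix can be read after the unfolding but not after the cactus letter, then there is a
witness of type 0. -/
theorem exists_isTypeZeroWitness (h : IsUnfolding A L u v x B F M₀) {Lg : ℕ → ℕ}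
    {z : List (Letter Q Sig)} (hz : IsSuffix A L Lg z)
    (h₁ : mwtAny (lw A) (u ++ wpow x (2 * bigM (AugState Q) * M₀) ++ v ++ z) A.augInit ≠ ⊤)
    (h₂ : mwtAny (lw A) (u ++ Letter.cactus B x :: v ++ z) A.augInit = ⊤) :
    ∃ w₁ B₁ w₂ w₃, IsTypeZeroWitness A L Lg w₁ B₁ w₂ w₃ := by
  have hnc := h.stable.nonnegCycles
  rw [List.append_assoc, List.append_assoc, mwtAny_append_ne_top] at h₁
  obtain ⟨s, hus, h₁⟩ := h₁
  rw [mwtAny_append_ne_top] at h₁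
  obtain ⟨r, hsr, hrz⟩ := h₁
  have hsB : s ∈ B := h.reach_subset (mem_reach_singleton.2 hus)
  have hrB : r ∈ B := mem_of_mwt_wpow_ne_top _ hnc.closed hsB hsr
  have hcac : ∀ t p, mwt (lw A) u A.augInit t ≠ ⊤ → Grounded (lw A) B x t p →
      mwtAny (lw A) (v ++ z) p = ⊤ := by
    intro t p ht hg
    by_contra hp
    rw [← not_ne_iff] at h₂
    apply h₂
    rw [List.append_assoc, mwtAny_append_ne_top]
    refine ⟨t, ht, ?_⟩
    rw [List.cons_append, ← List.singleton_append, mwtAny_append_ne_top]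
    refine ⟨p, ?_, hp⟩
    rwa [mwt_singleton, lw_cactus, stabWeight_ne_top_iff]
  -- For `M₀ = 0` the empty power would give `s = r` with weight 0 on a non-grounded pair, against
  -- the bound `F ≥ 0`.
  have hM₀ : 1 ≤ M₀ := by
    by_contra hM
    obtain rfl : M₀ = 0 := by omega
    have hng : ¬ Grounded (lw A) B x s r := fun hg => hrz (hcac s r hus hg)
    have h1 := (h.const 0 le_rfl s hsB r hrB).1 hng
    rw [eq_of_mwt_nil _ hsr, Nat.mul_zero, wpow_zero, mwt_nil_self] at h1
    norm_cast at h1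
  have hpow : ∀ k k', 1 ≤ k → 1 ≤ k' → ∀ q,
      mwt (lw A) (u ++ wpow x (2 * bigM (AugState Q) * k)) A.augInit q ≠ ⊤ →
      mwt (lw A) (u ++ wpow x (2 * bigM (AugState Q) * k')) A.augInit q ≠ ⊤ := by
    intro k k' hk hk' q hq
    obtain ⟨t, h1, h2⟩ := exists_of_mwt_append_ne_top _ hq
    exact mwt_append_ne_top _ h1 (mwt_wpow_ne_top_of_ne_top hk hk' h2)
  have htwo : u ++ wpow x (2 * bigM (AugState Q)) ++ wpow x (2 * bigM (AugState Q)) =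
      u ++ wpow x (2 * bigM (AugState Q) * 2) := by
    rw [List.append_assoc, ← wpow_add]
    congr 2
    ring
  have hone : u ++ wpow x (2 * bigM (AugState Q)) =
      u ++ wpow x (2 * bigM (AugState Q) * 1) := by rw [Nat.mul_one]
  have hr : mwt (lw A) (u ++ wpow x (2 * bigM (AugState Q) * M₀)) A.augInit r ≠ ⊤ :=
    mwt_append_ne_top _ hus hsr
  -- The prefix includes one power `x ^ (2 m)` because only from then on do further such powers
  -- leave the reachable set unchanged.
  refine ⟨u ++ wpow x (2 * bigM (AugState Q)), B, x, v ++ z, ?_, ?_, h.mem_cactus,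
    hz.append_left h.mem_right, ?_, ?_, ?_⟩
  · intro a ha
    exact h.mem_unfolded (2 * bigM (AugState Q)) a (List.mem_append_left _ ha)
  · obtain ⟨b, hb, -⟩ := h.stable
    ext t
    constructor
    · intro ht
      refine ⟨r, mem_reach_singleton.2 ?_, hb.sameFrame ht hrB⟩
      rw [hone]
      exact hpow _ _ hM₀ le_rfl r hr
    · rintro ⟨p, hp, htp⟩
      refine hb.mem_of_sameFrame ?_ htp
      obtain ⟨t', h1, h2⟩ := exists_of_mwt_append_ne_top _ (mem_reach_singleton.1 hp)
      exact mem_of_mwt_wpow_ne_top _ hnc.closed (h.reach_subset (mem_reach_singleton.2 h1)) h2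
  · ext q
    rw [mem_reach_singleton, mem_reach_singleton, htwo, hone]
    exact ⟨hpow _ _ le_rfl (by omega) q, hpow _ _ (by omega) le_rfl q⟩
  · rw [htwo, mwtAny_append_ne_top]
    exact ⟨r, hpow _ _ hM₀ (by omega) r hr, hrz⟩
  · by_contra hne
    rw [← ne_eq, mwtAny_append_ne_top] at hne
    obtain ⟨t, ht, hne⟩ := hne
    rw [← List.singleton_append, mwtAny_append_ne_top] at hne
    obtain ⟨p, htp, hp⟩ := hne
    rw [mwt_singleton, lw_cactus, stabWeight_ne_top_iff] at htp
    rw [hone] at ht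
    obtain ⟨t', h1, h2⟩ := exists_of_mwt_append_ne_top _ ht
    -- The state `t` is reached only after `u x ^ (2 m)`; groundedness of `(t, p)` pulls back to a
    -- state `t'` reached by `u`, where the cactus letter blocks `v ++ z`.
    exact hp (hcac t' p h1 (hnc.grounded_of_reach (h.stable.exists_zero_cycle _)
      (h.reach_subset (mem_reach_singleton.2 h1)) h2 htp))

theorem mwt_le (h : IsUnfolding A L u v x B F M₀) (q : AugState Q) :
    mwt (lw A) (u ++ wpow x (2 * bigM (AugState Q) * M₀) ++ v) A.augInit q ≤
      mwt (lw A) (u ++ Letter.cactus B x :: v) A.augInit q :=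
  h.const.mwt_le (lw_cactus A B x) u v _ q

theorem mwt_eq_or (h : IsUnfolding A L u v x B F M₀) (q : AugState Q) :
    mwt (lw A) (u ++ wpow x (2 * bigM (AugState Q) * M₀) ++ v) A.augInit q =
        mwt (lw A) (u ++ Letter.cactus B x :: v) A.augInit q ∨
      (mwt (lw A) (u ++ Letter.cactus B x :: v) A.augInit q = ⊤ ∧
        (((maxeff (lw A) (u ++ Letter.cactus B x :: v) : ℤ) : Weight) <
          mwt (lw A) (u ++ wpow x (2 * bigM (AugState Q) * M₀) ++ v) A.augInit q)) :=
  h.const.mwt_eq_or (lw_cactus A B x) h.stable.nonnegCycles.closed h.reach_subset h.bound q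

/-- Every finite weight after the cactus letter is exceeded by each weight that the unfolding
changes. -/
theorem mwt_lt_of_ne (h : IsUnfolding A L u v x B F M₀) {p q : AugState Q}
    (hp : mwt (lw A) (u ++ Letter.cactus B x :: v) A.augInit p ≠ ⊤)
    (hq : mwt (lw A) (u ++ wpow x (2 * bigM (AugState Q) * M₀) ++ v) A.augInit q ≠
      mwt (lw A) (u ++ Letter.cactus B x :: v) A.augInit q) :
    mwt (lw A) (u ++ Letter.cactus B x :: v) A.augInit p <
      mwt (lw A) (u ++ wpow x (2 * bigM (AugState Q) * M₀) ++ v) A.augInit q := by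
  refine lt_of_le_of_lt ?_ ((h.mwt_eq_or q).resolve_left hq).2
  obtain ⟨c, hc⟩ := WithTop.ne_top_iff_exists.1 hp
  have h1 := natAbs_le_maxeff _ hc.symm
  rw [← hc]
  norm_cast
  omega

/-- A changed weight lies above every old finite weight, so the unfolding puts no new state below
`q` and the same suffix still works. -/
theorem isDominant_unfold (h : IsUnfolding A L u v x B F M₀) {Lg : ℕ → ℕ} {q : AugState Q}
    (hq : IsDominant A L Lg (xconf (lw A) A.augInit (u ++ Letter.cactus B x :: v)) q) :
    IsDominant A L Lg
        (xconf (lw A) A.augInit (u ++ wpow x (2 * bigM (AugState Q) * M₀) ++ v)) q ∧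
      xconf (lw A) A.augInit (u ++ wpow x (2 * bigM (AugState Q) * M₀) ++ v) q =
        xconf (lw A) A.augInit (u ++ Letter.cactus B x :: v) q := by
  obtain ⟨h1, z, hz, hqz, hpz⟩ := hq
  simp only [xconf] at h1 hpz
  have heq := (h.mwt_eq_or q).resolve_right fun h2 => h1 h2.1
  refine ⟨⟨by simpa only [xconf, heq] using h1, z, hz, hqz, fun p hp => hpz p ?_⟩, heq⟩
  simp only [xconf, heq] at hp
  by_contra hlt
  refine (lt_asymm hp) (h.mwt_lt_of_ne h1 fun h2 => hlt ?_)
  rwa [← h2]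

/-- If the weight of `q` were changed, all states of the old configuration would lie below it and
block the suffix, giving a type-0 witness. So the weight is unchanged; old states below `q` remain
below it after unfolding, and the suffix is blocked there. -/
theorem isDominant_fold (h : IsUnfolding A L u v x B F M₀) {Lg : ℕ → ℕ}
    (hw : ¬ ∃ w₁ B₁ w₂ w₃, IsTypeZeroWitness A L Lg w₁ B₁ w₂ w₃) {q : AugState Q}
    (hq : IsDominant A L Lg
      (xconf (lw A) A.augInit (u ++ wpow x (2 * bigM (AugState Q) * M₀) ++ v)) q) :
    IsDominant A L Lg (xconf (lw A) A.augInit (u ++ Letter.cactus B x :: v)) q ∧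
      xconf (lw A) A.augInit (u ++ wpow x (2 * bigM (AugState Q) * M₀) ++ v) q =
        xconf (lw A) A.augInit (u ++ Letter.cactus B x :: v) q := by
  obtain ⟨h1, z, hz, hqz, hpz⟩ := hq
  simp only [xconf] at h1 hpz
  have heq : mwt (lw A) (u ++ wpow x (2 * bigM (AugState Q) * M₀) ++ v) A.augInit q =
      mwt (lw A) (u ++ Letter.cactus B x :: v) A.augInit q := by
    by_contra hne
    refine hw (h.exists_isTypeZeroWitness hz ((mwtAny_append_ne_top _).2 ⟨q, h1, hqz⟩) ?_)
    by_contra hz'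
    obtain ⟨p, hp, hpz'⟩ := (mwtAny_append_ne_top _).1 hz'
    exact hpz' (hpz p ((h.mwt_le p).trans_lt (h.mwt_lt_of_ne hp hne)))
  refine ⟨⟨by simpa only [xconf, ← heq] using h1, z, hz, hqz, fun p hp => hpz p ?_⟩, heq⟩
  rw [heq]
  exact (h.mwt_le p).trans_lt hp

theorem hasSeamlessBaselineRun_unfold (h : IsUnfolding A L u v x B F M₀)
    (hs : HasSeamlessBaselineRun A (u ++ Letter.cactus B x :: v)) :
    HasSeamlessBaselineRun A (u ++ wpow x (2 * bigM (AugState Q) * M₀) ++ v) := by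
  rw [hasSeamlessBaselineRun_iff (lengthBounded_of_mem h.mem)] at hs
  rw [hasSeamlessBaselineRun_iff (lengthBounded_of_mem (h.mem_unfolded _))]
  obtain ⟨⟨r, hr⟩, hs⟩ := hs
  have hpos : ∀ v', v' <+: v → ∀ t : AugState Q, t.IsBaseline →
      0 ≤ mwt (lw A) (u ++ wpow x (2 * bigM (AugState Q) * M₀) ++ v') A.augInit t := by
    intro v' hv' t ht
    rcases (h.of_prefix hv').mwt_eq_or t with h1 | h1
    · rw [h1]
      exact hs _ ((List.prefix_append_right_inj u).2 ((List.prefix_cons_inj _).2 hv')) t ht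
    · exact le_trans (by norm_cast; omega) h1.2.le
  refine ⟨⟨r, mem_reach_singleton.2
    (ne_top_of_le_ne_top (mem_reach_singleton.1 hr) (h.mwt_le r))⟩, fun w' hw' t ht => ?_⟩
  rcases prefix_append_cases hw' with hw' | ⟨v', hv', rfl⟩
  · rcases prefix_append_cases hw' with hw' | ⟨x', ⟨y, hy⟩, rfl⟩
    · exact hs _ (hw'.trans (List.prefix_append _ _)) t ht
    -- Inside the power of `x` there is no old prefix to compare with. The baseline state `t` can be
    -- continued at no cost along the rest `y` to the baseline state `b`, so a negative weight at
    -- `t` would give one at `b` after the whole power, which `hpos` excludes.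
    · by_cases htop : mwt (lw A) (u ++ x') A.augInit t = ⊤
      · simp [htop]
      obtain ⟨b, hb, hb0⟩ := h.stable
      have hxb := (hb0 (2 * bigM (AugState Q) * M₀)).2
      obtain ⟨p, hp, hpu⟩ := h.exists_mem_reach
      have hub := mwt_baseline_le_zero (lengthBounded_of_mem h.mem_left) hpu
      rw [A.isBaseline_augInit.baseline_eq (.refl _), hb.baseline_eq hp] at hub
      rw [← hy] at hxb
      obtain ⟨z, hz, hzb⟩ := exists_of_mwt_append_ne_top (lw A)
        (show mwt (lw A) (x' ++ y) b b ≠ ⊤ by rw [hxb]; exact WithTop.zero_ne_top)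
      have hmem : ∀ a ∈ x' ++ y, LengthBounded A L a := by
        rw [hy]
        exact fun a ha => lengthBounded_of_mem h.mem_inner a (mem_of_mem_wpow ha)
      have hux : ∀ a ∈ u ++ x', LengthBounded A L a := by
        intro a ha
        rcases List.mem_append.1 ha with ha | ha
        · exact lengthBounded_of_mem h.mem_left a ha
        · exact hmem a (List.mem_append_left _ ha)
      have htz := sameFrame_of_mwt hux htop (mwt_append_ne_top (lw A)
        (ne_top_of_le_ne_top WithTop.zero_ne_top hub) hz) (.refl _)
      have hyb := mwt_baseline_le_zero (fun a ha => hmem a (List.mem_append_right _ ha)) hzb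
      rw [ht.baseline_eq htz.symm, hb.1.baseline_eq (.refl _)] at hyb
      have h1 := hpos [] (List.nil_prefix) b hb.1
      rw [List.append_nil, ← hy, ← List.append_assoc] at h1
      exact h1.trans ((mwt_append_le _ _ _ _ t _).trans (add_le_of_nonpos_right hyb))
  · exact hpos v' hv' t ht

theorem hasSeamlessBaselineRun_fold (h : IsUnfolding A L u v x B F M₀)
    (hs : HasSeamlessBaselineRun A (u ++ wpow x (2 * bigM (AugState Q) * M₀) ++ v)) :
    HasSeamlessBaselineRun A (u ++ Letter.cactus B x :: v) := by
  rw [hasSeamlessBaselineRun_iff (lengthBounded_of_mem (h.mem_unfolded _))] at hs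
  rw [hasSeamlessBaselineRun_iff (lengthBounded_of_mem h.mem)]
  obtain ⟨⟨q, hq⟩, hs⟩ := hs
  constructor
  · obtain ⟨r, hr, hrq⟩ := exists_of_mwt_append_ne_top _ (mem_reach_singleton.1 hq)
    obtain ⟨t, ht, htr⟩ := exists_of_mwt_append_ne_top _ hr
    have htB := h.reach_subset (mem_reach_singleton.2 ht)
    have hrB := mem_of_mwt_wpow_ne_top _ h.stable.nonnegCycles.closed htB htr
    obtain ⟨b, hb, hb0⟩ := h.stable
    have hub := mwt_baseline_le_zero (lengthBounded_of_mem h.mem_left) ht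
    have hvb := mwt_baseline_le_zero (lengthBounded_of_mem h.mem_right) hrq
    rw [A.isBaseline_augInit.baseline_eq (.refl _), hb.baseline_eq htB] at hub
    rw [hb.baseline_eq hrB] at hvb
    -- Only the baseline run is sure to survive folding: the cactus letter has the transition `b →
    -- b`, while the pair `(t, r)` need not be grounded.
    refine ⟨q.baseline, mem_reach_singleton.2 (mwt_append_ne_top (lw A)
      (ne_top_of_le_ne_top WithTop.zero_ne_top hub) (ne_top_of_le_ne_top ?_
        (mwt_cons_le (lw A) _ v b b q.baseline)))⟩
    rw [lw_cactus, stabWeight_baseline hb hb0, zero_add]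
    exact ne_top_of_le_ne_top WithTop.zero_ne_top hvb
  · intro w' hw' t ht
    rcases prefix_append_cases hw' with hw' | ⟨v', hv', rfl⟩
    · exact hs _ (hw'.trans ((List.prefix_append _ _).trans (List.prefix_append _ _))) t ht
    · rcases List.prefix_cons_iff.1 hv' with rfl | ⟨v'', rfl, hv''⟩
      · rw [List.append_nil]
        exact hs _ ((List.prefix_append _ _).trans (List.prefix_append _ _)) t ht
      · exact (hs _ ((List.prefix_append_right_inj _).2 hv'') t ht).trans
          ((h.of_prefix hv'').mwt_le t)

end IsUnfolding

theorem HasPotential.readable {L Lg : ℕ → ℕ} {u v x : List (Letter Q Sig)} {B : Set (AugState Q)}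
    {P : ℤ} (h : HasPotential A L Lg (u ++ Letter.cactus B x :: v) P) :
    (reach (lw A) {A.augInit} (u ++ [Letter.cactus B x])).Nonempty := by
  obtain ⟨-, -, ⟨q, hq, -⟩, -⟩ := h
  have h1 : mwt (lw A) (u ++ Letter.cactus B x :: v) A.augInit q ≠ ⊤ := hq.1
  rw [← List.singleton_append, ← List.append_assoc] at h1
  obtain ⟨t, ht, -⟩ := exists_of_mwt_append_ne_top _ h1
  exact ⟨t, mem_reach_singleton.2 ht⟩

end Unfolding

end CactusWFA

open CactusWFA
theorem mainTheorem12 {Q Sig : Type*} [Fintype Q] [DecidableEq Q] (A : WFA Q Sig)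
    (Ls Lg : ℕ → ℕ) (u v x : List (Letter Q Sig)) (B : Set (AugState Q))
    (huv : ∀ a ∈ u ++ Letter.cactus B x :: v, a ∈ boundedCac A Ls)
    (F : ℕ) (hF : 2 * maxeff (lw A) (u ++ Letter.cactus B x :: v) ≤ F) :
    (∃ M₀, IsUnfoldingConstant (lw A) B x F M₀) ∧
    ∀ M₀, IsUnfoldingConstant (lw A) B x F M₀ → ∀ v', v' <+: v →
      xconf (lw A) A.augInit (u ++ wpow x (2 * bigM (AugState Q) * M₀) ++ v') ≤
        xconf (lw A) A.augInit (u ++ Letter.cactus B x :: v') ∧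
      ((∃ w₁ B₁ w₂ w₃, IsTypeZeroWitness A Ls Lg w₁ B₁ w₂ w₃) ∨
        ((∀ P : ℤ, HasPotential A Ls Lg (u ++ Letter.cactus B x :: v') P →
            HasPotential A Ls Lg (u ++ wpow x (2 * bigM (AugState Q) * M₀) ++ v') P) ∧
          ((reach (lw A) {A.augInit} (u ++ [Letter.cactus B x])).Nonempty → ∀ P : ℤ,
            HasPotential A Ls Lg (u ++ wpow x (2 * bigM (AugState Q) * M₀) ++ v') P →
              HasPotential A Ls Lg (u ++ Letter.cactus B x :: v') P))) := by
  have hstable : IsStableCycle A B x := by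
    obtain ⟨k, -, h, -⟩ := huv (Letter.cactus B x) (by simp)
    exact h.isStableCycle
  refine ⟨hstable.nonnegCycles.exists_isUnfoldingConstant (hstable.exists_zero_cycle _) F,
    fun M₀ hM v' hv' => ⟨fun q => hM.mwt_le (lw_cactus A B x) u v' _ q, ?_⟩⟩
  -- Absent a witness, both configurations have the same dominant states with the same weights. The
  -- witness is excluded for the upper bound on the unfolded side in one direction, and for
  -- attaining `P` on the folded side in the other.
  refine or_iff_not_imp_left.2 fun hw => ⟨fun P hP => ?_, fun hr P hP => ?_⟩
  · have h : IsUnfolding A Ls u v' x B F M₀ :=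
      IsUnfolding.of_prefix ⟨huv, hF, hM, hP.readable⟩ hv'
    obtain ⟨-, hs, ⟨q, hq, hqP⟩, hmax⟩ := hP
    refine ⟨jumpFree_of_lengthBounded (IsUnfolding.lengthBounded_of_mem (h.mem_unfolded _)),
      h.hasSeamlessBaselineRun_unfold hs,
      ⟨q, (h.isDominant_unfold hq).1, (h.isDominant_unfold hq).2.trans hqP⟩, fun p hp => ?_⟩
    obtain ⟨h1, h2⟩ := h.isDominant_fold hw hp
    rw [h2]
    exact hmax p h1
  · have h : IsUnfolding A Ls u v' x B F M₀ := IsUnfolding.of_prefix ⟨huv, hF, hM, hr⟩ hv'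
    obtain ⟨-, hs, ⟨q, hq, hqP⟩, hmax⟩ := hP
    obtain ⟨h1, h2⟩ := h.isDominant_fold hw hq
    refine ⟨jumpFree_of_lengthBounded (IsUnfolding.lengthBounded_of_mem h.mem),
      h.hasSeamlessBaselineRun_fold hs, ⟨q, h1, h2.symm.trans hqP⟩, fun p hp => ?_⟩
    obtain ⟨h3, h4⟩ := h.isDominant_unfold hp
    rw [← h4]
    exact hmax p h3
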